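/- **Setting.** Let $\mathcal W$ be a Polish space with its Borel $\sigma$-field and let $\nu$ be a nonatomic $\sigma$-finite measure on $\mathcal W$. Let $\mathcal M$ be the space of measures on $\mathcal W$, with the $\sigma$-field generated by the maps $\mu\mapsto\mu(B)$, $B$ Borel. Let $N$ be a Poisson random measure on $\mathcal W$ with mean measure $\nu$: the values of $N$ on disjoint Borel sets are independent, and $N(B)$ is Poisson with mean $\nu(B)$ whenever $\nu(B)<\infty$. Write $\mathcal P(dN|\nu)$ for its law on $\mathcal M$. Let $h:\mathcal W\times\mathcal M\to(0,\infty)$ be jointly measurable with $\int_{\mathcal W}h(w,N)\,N(dw)=1$ almost surely, and put $P(dw)=h(w,N)N(dw)$, a random probability measure. Let $\mathbf W=(W_1,\dots,W_n)$ be random elements of $\mathcal W$ which, given $P$, are i.i.d. with distribution $P$. **Notation.** For $\mathbf w\in\mathcal W^n$, let $\mathbf p$ be the partition of $\{1,\dots,n\}$ in which $i,i'$ share a cell iff $w_i=w_{i'}$, let $n(\mathbf p)$ be its number of cells, $w_1^*,\dots,w_{n(\mathbf p)}^*$ the distinct values of $\mathbf w$, and $e_j$ the number of indices $i$ with $w_i=w_j^*$.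 Put $N_n^*=N+\sum_{j=1}^{n(\mathbf p)}\delta_{w_j^*}$ and $$\psi_n(\mathbf w)=\int_{\mathcal M}\prod_{j=1}^{n(\mathbf p)}h(w_j^*,N_n^*)^{e_j}\,\mathcal P(dN|\nu),\qquad \pi^*(dN|\mathbf w)=\psi_n(\mathbf w)^{-1}\prod_{j=1}^{n(\mathbf p)}h(w_j^*,N_n^*)^{e_j}\,\mathcal P(dN|\nu).$$ The symbol $\prod_{j=1}^{n(\mathbf p)}\nu(dw_j^*)$ denotes the measure on $\mathcal W^n$ under which the integral of $g\ge 0$ is $\sum_{\mathbf p}\int_{\mathcal W^{n(\mathbf p)}}g(\mathbf w)\prod_{j=1}^{n(\mathbf p)}\nu(dw_j^*)$, the sum being over all partitions $\mathbf p$ of $\{1,\dots,n\}$ and $\mathbf w$ being the vector equal to $w_j^*$ on the $j$-th cell of $\mathbf p$. **Theorem 3.1.** Almost surely $0<\psi_n(\mathbf W)<\infty$, and the following hold. (i) The posterior distribution of $N$ given $\mathbf W$ is the law of $N_n^*=N+\sum_{j=1}^{n(\mathbf p)}\delta_{W_j^*}$, where, given $\mathbf W$, the measure $N$ in this sum has law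 $\pi^*(dN|\mathbf W)$. (ii) The posterior distribution of $P$ given $\mathbf W$ is the law of the random probability measure $$P_n^*(dw)=h(w,N_n^*)N_n^*(dw)=h(w,N_n^*)N(dw)+\sum_{j=1}^{n(\mathbf p)}h(W_j^*,N_n^*)\,\delta_{W_j^*}(dw),$$ where, given $\mathbf W$, the measure $N$ has law $\pi^*(dN|\mathbf W)$. (iii) The marginal distribution of $\mathbf W$ is exchangeable and equals $\psi_n(\mathbf w)\prod_{j=1}^{n(\mathbf p)}\nu(dw_j^*)$. The probability that the partition of $\{1,\dots,n\}$ induced by the ties of $\mathbf W$ equals a given partition $\mathbf p$ depends only on the multiset of cell sizes $e_1,\dots,e_{n(\mathbf p)}$ of $\mathbf p$, and it is $$p(e_1,\dots,e_{n(\mathbf p)})=\int_{\mathcal W^{n(\mathbf p)}}\psi_n(\mathbf w)\prod_{j=1}^{n(\mathbf p)}\nu(dw_j^*),$$ where $\mathbf w$ is the vector equal to $w_j^*$ on the $j$-th cell of $\mathbf p$. -/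

import Mathlib

open MeasureTheory ProbabilityTheory
open scoped ENNReal NNReal

namespace PoissonPartition

noncomputable section

/-- `N` is a Poisson random measure with mean measure `ν`, defined on the probability space
`(Ω, Pr)`.  The space of measures on `𝓦` carries the σ-field generated by the evaluations
`μ ↦ μ B`, `B` measurable.  (For σ-finite `ν` the values on sets of infinite mean are determined
by those on sets of finite mean.) -/
structure IsPoissonRandomMeasure {Ω 𝓦 : Type*} [MeasurableSpace Ω] [MeasurableSpace 𝓦]
    (N : Ω → Measure 𝓦) (ν : Measure 𝓦) (Pr : Measure Ω) : Prop where
  measurable : Measurable N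
  /-- The masses of finitely many disjoint sets are independent. -/
  indep : ∀ (k : ℕ) (A : Fin k → Set 𝓦), (∀ i, MeasurableSet (A i)) →
    Pairwise (Function.onFun Disjoint A) → iIndepFun (fun i ω => N ω (A i)) Pr
  /-- The mass of a set `B` of finite mean is Poisson distributed with mean `ν B`. -/
  poisson : ∀ B : Set 𝓦, MeasurableSet B → ν B ≠ ∞ →
    HasLaw (fun ω => N ω B)
      ((poissonMeasure (ν B).toNNReal).map (fun k : ℕ => (k : ℝ≥0∞))) Pr

/-- The function `K`, which sends a point `x` to a measure `K x`, is (almost surely) a regular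
version of the conditional distribution of `Y` given `X`. -/
def IsConditionalLaw {Ω 𝓧 𝓨 : Type*} [MeasurableSpace Ω] [MeasurableSpace 𝓧] [MeasurableSpace 𝓨]
    (Y : Ω → 𝓨) (X : Ω → 𝓧) (K : 𝓧 → Measure 𝓨) (Pr : Measure Ω) : Prop :=
  ∃ κ : Kernel 𝓧 𝓨, IsMarkovKernel κ ∧ (∀ᵐ ω ∂Pr, κ (X ω) = K (X ω)) ∧ HasCondDistrib Y X κ Pr

/-- The measure `h(w, N) N(dw)` built from a measure `N`. -/
def weighted {𝓦 : Type*} [MeasurableSpace 𝓦] (h : 𝓦 × Measure 𝓦 → ℝ≥0) (N : Measure 𝓦) :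
    Measure 𝓦 :=
  N.withDensity (fun w => (h (w, N) : ℝ≥0∞))

open Classical in
/-- The finite set of the distinct values `w₁*, …, w_{n(p)}*` of a vector `w = (w₁, …, w_n)`. -/
def distinctValues {𝓦 : Type*} {n : ℕ} (w : Fin n → 𝓦) : Finset 𝓦 :=
  Finset.univ.image w

open Classical in
/-- The number of indices `i` with `w i = v` (this is `e_j` for `v = w_j*`). -/
def multiplicity {𝓦 : Type*} {n : ℕ} (w : Fin n → 𝓦) (v : 𝓦) : ℕ :=
  (Finset.univ.filter (fun i => w i = v)).card

open Classical in
/-- The partition of `{1, …, n}` in which `i`, `i'` share a cell iff `w i = w i'`. -/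
def tiePartition {𝓦 : Type*} {n : ℕ} (w : Fin n → 𝓦) :
    Finpartition (Finset.univ : Finset (Fin n)) :=
  Finpartition.ofSetoid (Setoid.ker w)

/-- The vector `(w₁, …, w_n)` with `w_i = v_j` for `i` in the cell `C_j` of the partition `p`. -/
def assemble {𝓦 : Type*} {n : ℕ} (p : Finpartition (Finset.univ : Finset (Fin n)))
    (v : p.parts → 𝓦) : Fin n → 𝓦 :=
  fun i => v ⟨p.part i, p.part_mem.2 (Finset.mem_univ i)⟩

/-- The multiset of the cell sizes `e₁, …, e_{n(p)}` of a partition. -/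
def cellSizes {n : ℕ} (p : Finpartition (Finset.univ : Finset (Fin n))) : Multiset ℕ :=
  p.parts.val.map Finset.card

/-- The measure `∏_{j ≤ n(p)} ν(dw_j*)` on `𝓦ⁿ`: its integral of a function `g` is
`∑_p ∫ g(w) ∏_{j ≤ n(p)} ν(dw_j*)`, where `p` ranges over all partitions of `{1, …, n}` and `w` is
the vector that takes the value `w_j*` on the `j`-th cell of `p`. -/
def partitionMeasure {𝓦 : Type*} [MeasurableSpace 𝓦] (ν : Measure 𝓦) (n : ℕ) :
    Measure (Fin n → 𝓦) :=
  ∑ p : Finpartition (Finset.univ : Finset (Fin n)),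
    (Measure.pi (fun _ : p.parts => ν)).map (assemble p)

/-- `N_n* = N + ∑_j δ_{w_j*}`. -/
def starMeasure {𝓦 : Type*} [MeasurableSpace 𝓦] {n : ℕ} (w : Fin n → 𝓦) (N : Measure 𝓦) :
    Measure 𝓦 :=
  N + ∑ v ∈ distinctValues w, Measure.dirac v

/-- The likelihood factor `∏_j h(w_j*, N_n*)^{e_j}`. -/
def likelihood {𝓦 : Type*} [MeasurableSpace 𝓦] {n : ℕ} (h : 𝓦 × Measure 𝓦 → ℝ≥0)
    (w : Fin n → 𝓦) (N : Measure 𝓦) : ℝ≥0∞ :=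
  ∏ v ∈ distinctValues w, (h (v, starMeasure w N) : ℝ≥0∞) ^ multiplicity w v

/-- `ψ_n(w) = ∫ ∏_j h(w_j*, N_n*)^{e_j} Q(dN)`, where `Q` is the law of `N`. -/
def psi {𝓦 : Type*} [MeasurableSpace 𝓦] {n : ℕ} (h : 𝓦 × Measure 𝓦 → ℝ≥0)
    (Q : Measure (Measure 𝓦)) (w : Fin n → 𝓦) : ℝ≥0∞ :=
  ∫⁻ N, likelihood h w N ∂Q

/-- `π*(dN | w) = ψ_n(w)⁻¹ ∏_j h(w_j*, N_n*)^{e_j} Q(dN)`, where `Q` is the law of `N`. -/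
def piStar {𝓦 : Type*} [MeasurableSpace 𝓦] {n : ℕ} (h : 𝓦 × Measure 𝓦 → ℝ≥0)
    (Q : Measure (Measure 𝓦)) (w : Fin n → 𝓦) : Measure (Measure 𝓦) :=
  Q.withDensity (fun N => (psi h Q w)⁻¹ * likelihood h w N)

end

end PoissonPartition

namespace PoissonPartition

open Set Function

section PoissonLaw

theorem lintegral_natCast_mul_poissonMeasure (r : ℝ≥0) (g : ℕ → ℝ≥0∞) :
    ∫⁻ k, (k : ℝ≥0∞) * g k ∂(poissonMeasure r) = r * ∫⁻ k, g (k + 1) ∂(poissonMeasure r) := by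
  have hsum : ∀ f : ℕ → ℝ≥0∞, ∫⁻ k, f k ∂(poissonMeasure r) =
      ∑' k, ENNReal.ofReal (Real.exp (-r) * r ^ k / (k.factorial : ℝ)) * f k := by
    intro f
    rw [poissonMeasure, lintegral_sum_measure]
    simp [lintegral_smul_measure]
  rw [hsum, hsum, tsum_eq_zero_add' ENNReal.summable, ← ENNReal.tsum_mul_left]
  simp only [Nat.cast_zero, zero_mul, mul_zero, zero_add]
  refine tsum_congr fun k => ?_
  rw [← mul_assoc, ← mul_assoc]
  congr 1
  rw [← ENNReal.ofReal_coe_nnreal, ← ENNReal.ofReal_natCast,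
    ← ENNReal.ofReal_mul (by positivity), ← ENNReal.ofReal_mul (by positivity)]
  congr 1
  rw [Nat.factorial_succ]
  push_cast
  field_simp
  ring

/-- The law of a Poisson variable, as a measure on `[0, ∞]`. -/
noncomputable abbrev poissonENNReal (r : ℝ≥0) : Measure ℝ≥0∞ :=
  (poissonMeasure r).map (fun k : ℕ => (k : ℝ≥0∞))

theorem lintegral_mul_poissonENNReal (r : ℝ≥0) {g : ℝ≥0∞ → ℝ≥0∞} (hg : Measurable g) :
    ∫⁻ t, t * g t ∂(poissonENNReal r) = r * ∫⁻ t, g (t + 1) ∂(poissonENNReal r) := by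
  rw [lintegral_map (by fun_prop) (by fun_prop), lintegral_map (by fun_prop) (by fun_prop),
    lintegral_natCast_mul_poissonMeasure r (fun k => g k)]
  simp

theorem lintegral_eval_mul_pi_poissonENNReal {ι : Type*} [Fintype ι] [DecidableEq ι] (r : ι → ℝ≥0)
    (j : ι) {F : (ι → ℝ≥0∞) → ℝ≥0∞} (hF : Measurable F) :
    ∫⁻ x, x j * F x ∂(Measure.pi fun i => poissonENNReal (r i)) =
      r j * ∫⁻ x, F (x + Pi.single j 1) ∂(Measure.pi fun i => poissonENNReal (r i)) := by
  have hm1 : Measurable fun x : ι → ℝ≥0∞ => x j * F x := by fun_prop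
  have hm2 : Measurable fun x : ι → ℝ≥0∞ => F (x + Pi.single j 1) :=
    hF.comp (by fun_prop)
  rw [← lintegral_const_mul _ hm2, lintegral_eq_lmarginal_univ 0, lintegral_eq_lmarginal_univ 0,
    lmarginal_erase' _ hm1 (Finset.mem_univ j),
    lmarginal_erase' _ (hm2.const_mul _) (Finset.mem_univ j)]
  congr 1
  funext x
  have hu : ∀ t : ℝ≥0∞, update x j t + Pi.single j 1 = update x j (t + 1) := by
    intro t
    ext i
    by_cases h : i = j
    · subst h; simp
    · simp [h]
  simp only [update_self, hu]
  have hF' : Measurable fun t => F (update x j t) := hF.comp (by fun_prop)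
  rw [lintegral_mul_poissonENNReal (r j) hF', lintegral_const_mul _ (by fun_prop)]

end PoissonLaw

section LocallyFinite

variable {𝓦 : Type*} [MeasurableSpace 𝓦] (ν : Measure 𝓦) [SigmaFinite ν]

/-- The measures that are finite on the members of a fixed exhausting sequence for `ν`. -/
def locallyFinite : Set (Measure 𝓦) := {N | ∀ i, N (spanningSets ν i) < ∞}

theorem measurableSet_locallyFinite : MeasurableSet (locallyFinite ν) := by
  simp only [locallyFinite, ofPred_forall]
  exact MeasurableSet.iInter fun i =>
    measurableSet_lt (Measure.measurable_coe (measurableSet_spanningSets ν i)) measurable_const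

variable {ν} in
theorem sigmaFinite_of_mem_locallyFinite {N : Measure 𝓦} (hN : N ∈ locallyFinite ν) :
    SigmaFinite N :=
  ⟨⟨⟨spanningSets ν, fun _ => trivial, hN, iUnion_spanningSets ν⟩⟩⟩

variable {ν} in
theorem add_mem_locallyFinite {N M : Measure 𝓦} (hN : N ∈ locallyFinite ν) [IsFiniteMeasure M] :
    N + M ∈ locallyFinite ν := fun i => by
  rw [Measure.add_apply]
  exact ENNReal.add_lt_top.2 ⟨hN i, measure_lt_top _ _⟩

open Classical in
/-- The kernel that sends a measure finite on the exhausting sequence of `ν` to itself, and every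
other measure to `0`. -/
noncomputable def evalKernel : Kernel (Measure 𝓦) 𝓦 :=
  Kernel.piecewise (measurableSet_locallyFinite ν) ⟨id, measurable_id⟩ 0

variable {ν} in
theorem evalKernel_apply_of_mem {N : Measure 𝓦} (hN : N ∈ locallyFinite ν) :
    evalKernel ν N = N := by
  classical
  rw [evalKernel, Kernel.piecewise_apply, if_pos hN]; rfl

variable {ν} in
theorem evalKernel_apply_of_notMem {N : Measure 𝓦} (hN : N ∉ locallyFinite ν) :
    evalKernel ν N = 0 := by
  classical
  rw [evalKernel, Kernel.piecewise_apply, if_neg hN]; rfl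

/-- A kernel all of whose measures are finite is s-finite. -/
theorem isSFiniteKernel_of_apply_univ_lt_top {α β : Type*} [MeasurableSpace α] [MeasurableSpace β]
    (κ : Kernel α β) (hκ : ∀ a, κ a univ < ∞) : IsSFiniteKernel κ := by
  have hu : Measurable fun a => κ a univ := κ.measurable_coe MeasurableSet.univ
  let η : Kernel α β := ⟨fun a => (κ a univ + 1)⁻¹ • κ a, by
    refine Measure.measurable_of_measurable_coe _ fun s hs => ?_
    simp only [Measure.smul_apply, smul_eq_mul]
    exact (hu.add_const 1).inv.mul (κ.measurable_coe hs)⟩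
  have hη : ∀ a, η a = (κ a univ + 1)⁻¹ • κ a := fun _ => rfl
  have : IsFiniteKernel η := ⟨1, by simp, fun a => by
    rw [hη, Measure.smul_apply, smul_eq_mul, mul_comm, ← div_eq_mul_inv]
    exact ENNReal.div_le_of_le_mul (by simp)⟩
  have hm : Measurable (uncurry fun (a : α) (_ : β) => κ a univ + 1) := by
    exact (hu.add_const 1).comp measurable_fst
  have : κ = η.withDensity (fun a _ => κ a univ + 1) := by
    ext1 a
    rw [Kernel.withDensity_apply _ hm, withDensity_const, hη, smul_smul,
      ENNReal.mul_inv_cancel (by simp) (by simp [(hκ a).ne]), one_smul]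
  rw [this]
  exact Kernel.IsSFiniteKernel.withDensity _ fun a b => by simp [(hκ a).ne]

instance : IsSFiniteKernel (evalKernel ν) := by
  have hd := fun i => (MeasurableSet.disjointed (measurableSet_spanningSets ν)) i
  have : evalKernel ν =
      Kernel.sum fun i => (evalKernel ν).restrict (hd i) := by
    ext1 N
    rw [Kernel.sum_apply]
    simp only [Kernel.restrict_apply]
    rw [← Measure.restrict_iUnion (disjoint_disjointed _) hd, iUnion_disjointed,
      iUnion_spanningSets, Measure.restrict_univ]
  rw [this]
  refine @Kernel.isSFiniteKernel_sum _ _ _ _ _ _ _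
    fun i => isSFiniteKernel_of_apply_univ_lt_top _ fun N => ?_
  rw [Kernel.restrict_apply, Measure.restrict_apply_univ]
  by_cases hN : N ∈ locallyFinite ν
  · rw [evalKernel_apply_of_mem hN]
    exact (measure_mono (disjointed_subset _ i)).trans_lt (hN i)
  · simp [evalKernel_apply_of_notMem hN]

instance sigmaFinite_evalKernel (N : Measure 𝓦) : SigmaFinite (evalKernel ν N) := by
  by_cases hN : N ∈ locallyFinite ν
  · rw [evalKernel_apply_of_mem hN]; exact sigmaFinite_of_mem_locallyFinite hN
  · rw [evalKernel_apply_of_notMem hN]; infer_instance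

end LocallyFinite

section Cells

variable {𝓦 ι : Type*}

open Classical in
/-- The set of the points that lie in `D i` exactly for `i ∈ s`; it is empty for `s = ∅`. -/
def cell (D : ι → Set 𝓦) (s : Finset ι) : Set 𝓦 :=
  if s.Nonempty then {w | ∀ i, w ∈ D i ↔ i ∈ s} else ∅

variable {D : ι → Set 𝓦}

theorem mem_cell {s : Finset ι} {w : 𝓦} :
    w ∈ cell D s ↔ s.Nonempty ∧ ∀ i, w ∈ D i ↔ i ∈ s := by
  by_cases hs : s.Nonempty <;> simp [cell, hs]

theorem cell_subset {s : Finset ι} {i : ι} (hi : i ∈ s) : cell D s ⊆ D i :=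
  fun _ hw => ((mem_cell.1 hw).2 i).2 hi

theorem pairwise_disjoint_cell : Pairwise (Disjoint on cell D) := by
  intro s t hst
  refine Set.disjoint_left.2 fun w hs ht => hst ?_
  ext i
  rw [← (mem_cell.1 hs).2 i, (mem_cell.1 ht).2 i]

open Classical in
theorem eq_iUnion_cell [Fintype ι] (i : ι) : D i = ⋃ s ∈ Finset.univ.filter (i ∈ ·), cell D s := by
  ext w
  simp only [mem_iUnion, Finset.mem_filter, Finset.mem_univ, true_and, exists_prop]
  constructor
  · intro hw
    refine ⟨Finset.univ.filter (w ∈ D ·), by simpa using hw,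
      mem_cell.2 ⟨⟨i, by simpa using hw⟩, ?_⟩⟩
    simp
  · rintro ⟨s, hs, hw⟩
    exact cell_subset hs hw

variable [MeasurableSpace 𝓦]

theorem measurableSet_cell [Fintype ι] (hD : ∀ i, MeasurableSet (D i)) (s : Finset ι) :
    MeasurableSet (cell D s) := by
  classical
  unfold cell
  split_ifs
  · simp only [ofPred_forall]
    refine MeasurableSet.iInter fun i => ?_
    by_cases hi : i ∈ s
    · simpa [hi] using hD i
    · simp only [hi, iff_false]
      exact (hD i).compl
  · exact MeasurableSet.empty

theorem measure_cell_ne_top {ν : Measure 𝓦} (hν : ∀ i, ν (D i) ≠ ∞) (s : Finset ι) :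
    ν (cell D s) ≠ ∞ := by
  by_cases hs : s.Nonempty
  · obtain ⟨i, hi⟩ := hs
    exact ne_top_of_le_ne_top (hν i) (measure_mono (cell_subset hi))
  · simp [cell, hs]

open Classical in
theorem measure_eq_sum_cell [Fintype ι] (hD : ∀ i, MeasurableSet (D i)) (M : Measure 𝓦) (i : ι) :
    M (D i) = ∑ s ∈ Finset.univ.filter (i ∈ ·), M (cell D s) := by
  conv_lhs => rw [eq_iUnion_cell (D := D) i]
  exact measure_biUnion_finset (fun s _ t _ hst => pairwise_disjoint_cell hst)
    fun s _ => measurableSet_cell hD s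

end Cells

section Mecke

variable {Ω 𝓦 : Type*} [MeasurableSpace Ω] [MeasurableSpace 𝓦] {Pr : Measure Ω}
  {ν : Measure 𝓦} {N : Ω → Measure 𝓦}

namespace IsPoissonRandomMeasure

theorem measurable_apply (hN : IsPoissonRandomMeasure N ν Pr) {B : Set 𝓦} (hB : MeasurableSet B) :
    Measurable fun ω => N ω B := (Measure.measurable_coe hB).comp hN.measurable

theorem ae_apply_lt_top (hN : IsPoissonRandomMeasure N ν Pr) {B : Set 𝓦} (hB : MeasurableSet B)
    (hνB : ν B ≠ ∞) : ∀ᵐ ω ∂Pr, N ω B < ∞ := by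
  have h := (hN.poisson B hB hνB).map_eq
  have hf := hN.measurable_apply hB
  have : ∀ᵐ t ∂(Pr.map fun ω => N ω B), t < ∞ := by
    rw [h, ae_map_iff (by fun_prop) measurableSet_Iio]
    simp
  exact ae_of_ae_map hf.aemeasurable this

theorem ae_mem_locallyFinite [SigmaFinite ν] (hN : IsPoissonRandomMeasure N ν Pr) :
    ∀ᵐ ω ∂Pr, N ω ∈ locallyFinite ν :=
  ae_all_iff.2 fun i => hN.ae_apply_lt_top (measurableSet_spanningSets ν i)
    (measure_spanningSets_lt_top ν i).ne

theorem ae_map_mem_locallyFinite [SigmaFinite ν] (hN : IsPoissonRandomMeasure N ν Pr) :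
    ∀ᵐ M ∂(Pr.map N), M ∈ locallyFinite ν :=
  (ae_map_iff hN.measurable.aemeasurable (measurableSet_locallyFinite ν)).2 hN.ae_mem_locallyFinite

theorem map_apply_eq_pi [IsProbabilityMeasure Pr] (hN : IsPoissonRandomMeasure N ν Pr)
    {ι : Type*} [Fintype ι] {C : ι → Set 𝓦} (hC : ∀ i, MeasurableSet (C i))
    (hd : Pairwise (Disjoint on C)) (hν : ∀ i, ν (C i) ≠ ∞) :
    Pr.map (fun ω i => N ω (C i)) = Measure.pi fun i => poissonENNReal (ν (C i)).toNNReal := by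
  let e := Fintype.equivFin ι
  have h1 := hN.indep (Fintype.card ι) (fun k => C (e.symm k)) (fun k => hC _)
    (hd.comp_of_injective e.symm.injective)
  have h2 := h1.precomp e.injective
  simp only [Equiv.symm_apply_apply] at h2
  rw [h2.map_fun_eq_pi_map fun i => (hN.measurable_apply (hC i)).aemeasurable]
  congr 1
  funext i
  exact (hN.poisson (C i) (hC i) (hν i)).map_eq

theorem lintegral_apply_mul_disjoint [IsProbabilityMeasure Pr] (hN : IsPoissonRandomMeasure N ν Pr)
    {ι : Type*} [Fintype ι] [DecidableEq ι] {C : ι → Set 𝓦} (hC : ∀ i, MeasurableSet (C i))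
    (hd : Pairwise (Disjoint on C)) (hν : ∀ i, ν (C i) ≠ ∞) (j : ι) {F : (ι → ℝ≥0∞) → ℝ≥0∞}
    (hF : Measurable F) :
    ∫⁻ ω, N ω (C j) * F (fun i => N ω (C i)) ∂Pr =
      ν (C j) * ∫⁻ ω, F ((fun i => N ω (C i)) + Pi.single j 1) ∂Pr := by
  have hm : Measurable fun ω i => N ω (C i) :=
    measurable_pi_lambda _ fun i => hN.measurable_apply (hC i)
  have h := lintegral_eval_mul_pi_poissonENNReal (fun i => (ν (C i)).toNNReal) j hF
  rw [← hN.map_apply_eq_pi hC hd hν, lintegral_map (by fun_prop) hm,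
    lintegral_map (by fun_prop) hm, ENNReal.coe_toNNReal (hν j)] at h
  exact h

theorem lintegral_apply_mul [IsProbabilityMeasure Pr] (hN : IsPoissonRandomMeasure N ν Pr)
    {ι : Type*} [Fintype ι] {D : ι → Set 𝓦} (hD : ∀ i, MeasurableSet (D i))
    (hν : ∀ i, ν (D i) ≠ ∞) (j : ι) {F : (ι → ℝ≥0∞) → ℝ≥0∞} (hF : Measurable F) :
    ∫⁻ ω, N ω (D j) * F (fun i => N ω (D i)) ∂Pr =
      ∫⁻ w in D j, ∫⁻ ω, F (fun i => (N ω + Measure.dirac w) (D i)) ∂Pr ∂ν := by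
  classical
  let A : (Finset ι → ℝ≥0∞) → ι → ℝ≥0∞ := fun x i => ∑ s ∈ Finset.univ.filter (i ∈ ·), x s
  have hA : Measurable A := by
    refine measurable_pi_lambda _ fun i => ?_
    exact Finset.measurable_fun_sum _ fun s _ => measurable_pi_apply s
  have hAM : ∀ M : Measure 𝓦, (fun i => M (D i)) = A fun s => M (cell D s) := fun M =>
    funext fun i => measure_eq_sum_cell hD M i
  have hFA : Measurable fun x => F (A x) := hF.comp hA
  have hcell : ∀ s : Finset ι, Measurable fun ω => N ω (cell D s) := fun s =>
    hN.measurable_apply (measurableSet_cell hD s)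
  have hcell' : Measurable fun ω (s : Finset ι) => N ω (cell D s) := measurable_pi_lambda _ hcell
  calc ∫⁻ ω, N ω (D j) * F (fun i => N ω (D i)) ∂Pr
      = ∑ s ∈ Finset.univ.filter (j ∈ ·),
          ∫⁻ ω, N ω (cell D s) * F (A fun s => N ω (cell D s)) ∂Pr := by
        have hm : ∀ s ∈ Finset.univ.filter (j ∈ ·),
            Measurable fun ω => N ω (cell D s) * F (A fun s => N ω (cell D s)) :=
          fun s _ => (hcell s).mul (hFA.comp hcell')
        rw [← lintegral_finsetSum _ hm]
        simp_rw [hAM, ← Finset.sum_mul]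
        refine lintegral_congr fun ω => ?_
        rw [measure_eq_sum_cell hD (N ω) j]
    _ = ∑ s ∈ Finset.univ.filter (j ∈ ·),
          ∫⁻ w in cell D s, ∫⁻ ω, F (fun i => (N ω + Measure.dirac w) (D i)) ∂Pr ∂ν := by
        refine Finset.sum_congr rfl fun s _ => ?_
        rw [hN.lintegral_apply_mul_disjoint (measurableSet_cell hD) pairwise_disjoint_cell
          (measure_cell_ne_top hν) s hFA]
        rw [mul_comm, ← setLIntegral_const]
        refine setLIntegral_congr_fun (measurableSet_cell hD s) fun w hw => ?_
        refine lintegral_congr fun ω => ?_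
        rw [hAM]
        congr 2
        funext t
        rw [Pi.add_apply, Measure.add_apply, Measure.dirac_apply' _ (measurableSet_cell hD t)]
        congr 1
        by_cases hst : t = s
        · subst hst; simp [hw]
        · have : w ∉ cell D t := fun h =>
            Set.disjoint_left.1 (pairwise_disjoint_cell hst) h hw
          simp [hst, this]
    _ = ∫⁻ w in D j, ∫⁻ ω, F (fun i => (N ω + Measure.dirac w) (D i)) ∂Pr ∂ν := by
        conv_rhs => rw [eq_iUnion_cell (D := D) j]
        rw [lintegral_biUnion_finset (fun s _ t _ hst => pairwise_disjoint_cell hst)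
          fun s _ => measurableSet_cell hD s]

end IsPoissonRandomMeasure

/-- The `σ`-field on the measures is generated by the masses of the sets of finite `ν`-measure. -/
theorem generateFrom_piiUnionInter_eval [SigmaFinite ν] :
    MeasurableSpace.generateFrom (piiUnionInter
      (fun D : Set 𝓦 =>
        {s | MeasurableSet[MeasurableSpace.comap (fun M : Measure 𝓦 => M D) inferInstance] s})
      {D | MeasurableSet D ∧ ν D ≠ ∞}) = Measure.instMeasurableSpace := by
  refine (generateFrom_piiUnionInter_measurableSet
    (fun D : Set 𝓦 => MeasurableSpace.comap (fun M : Measure 𝓦 => M D) inferInstance) _).trans ?_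
  refine le_antisymm (iSup₂_le fun D hD => (Measure.measurable_coe hD.1).comap_le) ?_
  refine iSup₂_le fun D hD => ?_
  rw [← measurable_iff_comap_le]
  have : (fun M : Measure 𝓦 => M D) = fun M => ⨆ i, M (D ∩ spanningSets ν i) := by
    funext M
    rw [← Monotone.measure_iUnion, ← inter_iUnion, iUnion_spanningSets, inter_univ]
    exact fun i k hik => inter_subset_inter_right _ (monotone_spanningSets ν hik)
  rw [this]
  refine Measurable.iSup fun i => ?_
  rw [measurable_iff_comap_le]
  exact le_iSup₂_of_le (f := fun (D : Set 𝓦) (_ : D ∈ {D | MeasurableSet D ∧ ν D ≠ ∞}) =>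
      MeasurableSpace.comap (fun M : Measure 𝓦 => M D) inferInstance) (D ∩ spanningSets ν i)
    ⟨hD.inter (measurableSet_spanningSets ν i), ne_top_of_le_ne_top
      (measure_spanningSets_lt_top ν i).ne (measure_mono inter_subset_right)⟩ le_rfl

theorem measurable_add_dirac :
    Measurable fun x : Measure 𝓦 × 𝓦 => x.1 + Measure.dirac x.2 := by
  refine Measure.measurable_of_measurable_coe _ fun s hs => ?_
  simp only [Measure.add_apply]
  exact ((Measure.measurable_coe hs).comp measurable_fst).add
    (((Measure.measurable_coe hs).comp Measure.measurable_dirac).comp measurable_snd)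

namespace IsPoissonRandomMeasure

theorem compProd_evalKernel [SigmaFinite ν] [IsProbabilityMeasure Pr]
    (hN : IsPoissonRandomMeasure N ν Pr) :
    (Pr.map N) ⊗ₘ evalKernel ν =
      ((Pr.map N).prod ν).map fun x => (x.1 + Measure.dirac x.2, x.2) := by
  classical
  have : IsProbabilityMeasure (Pr.map N) :=
    Measure.isProbabilityMeasure_map hN.measurable.aemeasurable
  have hphi : Measurable fun x : Measure 𝓦 × 𝓦 => (x.1 + Measure.dirac x.2, x.2) :=
    measurable_add_dirac.prodMk measurable_snd
  set 𝒞 := piiUnionInter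
      (fun D : Set 𝓦 =>
        {s | MeasurableSet[MeasurableSpace.comap (fun M : Measure 𝓦 => M D) inferInstance] s})
      {D | MeasurableSet D ∧ ν D ≠ ∞} with h𝒞
  set 𝒟 := {B : Set 𝓦 | MeasurableSet B ∧ ν B ≠ ∞} with h𝒟
  have h𝒞u : univ ∈ 𝒞 := ⟨∅, by simp, fun _ => univ, by simp, by simp⟩
  have hspan : ∀ i, spanningSets ν i ∈ 𝒟 := fun i =>
    ⟨measurableSet_spanningSets ν i, (measure_spanningSets_lt_top ν i).ne⟩
  have h𝒟g : MeasurableSpace.generateFrom 𝒟 = ‹MeasurableSpace 𝓦› := by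
    refine le_antisymm (MeasurableSpace.generateFrom_le fun s hs => hs.1) fun s hs => ?_
    have : s = ⋃ i, s ∩ spanningSets ν i := by
      rw [← inter_iUnion, iUnion_spanningSets, inter_univ]
    rw [this]
    exact MeasurableSet.iUnion fun i => MeasurableSpace.measurableSet_generateFrom
      ⟨hs.inter (measurableSet_spanningSets ν i), ne_top_of_le_ne_top
        (measure_spanningSets_lt_top ν i).ne (measure_mono inter_subset_right)⟩
  have h𝒞m : ∀ E ∈ 𝒞, MeasurableSet E := fun E hE => by
    rw [← generateFrom_piiUnionInter_eval (ν := ν)]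
    exact MeasurableSpace.measurableSet_generateFrom hE
  have key : ∀ E ∈ 𝒞, ∀ B ∈ 𝒟, ((Pr.map N) ⊗ₘ evalKernel ν) (E ×ˢ B) =
      (((Pr.map N).prod ν).map fun x => (x.1 + Measure.dirac x.2, x.2)) (E ×ˢ B) := by
    intro E hE B hB
    have hEm := h𝒞m E hE
    obtain ⟨t, ht, f, hf, rfl⟩ := hE
    choose! T hTm hT using hf
    rw [Measure.compProd_apply_prod hEm hB.1, Measure.map_apply hphi (hEm.prod hB.1),
      Measure.prod_apply_symm (hphi (hEm.prod hB.1)), ← lintegral_indicator hEm,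
      lintegral_map ((Measurable.indicator (Kernel.measurable_coe _ hB.1) hEm)) hN.measurable]
    let D : Option t → Set 𝓦 := fun o => o.elim B fun D => D.1
    have hD : ∀ o, D o ∈ 𝒟 := by
      rintro (_ | o)
      · exact hB
      · exact ht o.2
    let S : Set (Option t → ℝ≥0∞) := ⋂ o : t, (fun x => x (some o)) ⁻¹' T o
    have hS : MeasurableSet S := MeasurableSet.iInter fun o =>
      measurable_pi_apply (some o) (hTm o o.2)
    have hmem : ∀ M : Measure 𝓦, M ∈ (⋂ x ∈ t, f x) ↔ (fun o => M (D o)) ∈ S := by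
      intro M
      simp only [mem_iInter, S, mem_preimage, D, Option.elim, Subtype.forall]
      refine forall₂_congr fun x hx => ?_
      rw [← hT x hx]; rfl
    have hmain := hN.lintegral_apply_mul (fun o => (hD o).1) (fun o => (hD o).2) none
      (F := S.indicator 1) (measurable_one.indicator hS)
    calc ∫⁻ ω, (⋂ x ∈ t, f x).indicator (fun a => evalKernel ν a B) (N ω) ∂Pr
        = ∫⁻ ω, N ω (D none) * S.indicator 1 (fun i => N ω (D i)) ∂Pr := by
          refine lintegral_congr_ae ?_
          filter_upwards [hN.ae_mem_locallyFinite] with ω hω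
          by_cases h : N ω ∈ (⋂ x ∈ t, f x)
          · rw [indicator_of_mem h, indicator_of_mem ((hmem _).1 h), evalKernel_apply_of_mem hω]
            simp [D]
          · rw [indicator_of_notMem h, indicator_of_notMem (fun h' => h ((hmem _).2 h'))]
            simp
      _ = _ := hmain
      _ = _ := by
          change ∫⁻ w in B, _ ∂ν = _
          rw [← lintegral_indicator hB.1]
          refine lintegral_congr fun w => ?_
          have hadd : Measurable fun M : Measure 𝓦 => M + Measure.dirac w :=
            measurable_add_dirac.comp (measurable_id.prodMk measurable_const)
          by_cases hw : w ∈ B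
          · rw [indicator_of_mem hw]
            have : (fun x => (x, w)) ⁻¹' ((fun x : Measure 𝓦 × 𝓦 => (x.1 + Measure.dirac x.2, x.2)) ⁻¹'
                ((⋂ x ∈ t, f x) ×ˢ B)) = (fun M => M + Measure.dirac w) ⁻¹' (⋂ x ∈ t, f x) := by
              ext M; simp [hw]
            rw [this, Measure.map_apply hN.measurable (hadd hEm), ← lintegral_indicator_one
              (hN.measurable (hadd hEm))]
            refine lintegral_congr fun ω => ?_
            refine indicator_eq_indicator (s := S) ?_ rfl
            rw [mem_preimage, mem_preimage, hmem]
          · rw [indicator_of_notMem hw]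
            have : (fun x => (x, w)) ⁻¹' ((fun x : Measure 𝓦 × 𝓦 => (x.1 + Measure.dirac x.2, x.2)) ⁻¹'
                ((⋂ x ∈ t, f x) ×ˢ B)) = ∅ := by
              ext M; simp [hw]
            rw [this, measure_empty]
  refine Measure.ext_of_generateFrom_of_iUnion (image2 (· ×ˢ ·) 𝒞 𝒟)
    (fun i => univ ×ˢ spanningSets ν i) ?_ ?_ ?_ ?_ ?_ ?_
  · exact (generateFrom_eq_prod (generateFrom_piiUnionInter_eval (ν := ν)) h𝒟g
      ⟨fun _ => univ, fun _ => h𝒞u, iUnion_const _⟩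
      ⟨spanningSets ν, hspan, iUnion_spanningSets ν⟩).symm
  · refine IsPiSystem.prod (isPiSystem_piiUnionInter _ (fun D => ?_) _) ?_
    · exact @MeasurableSpace.isPiSystem_measurableSet _
        (MeasurableSpace.comap (fun M : Measure 𝓦 => M D) inferInstance)
    · rintro B hB B' hB' -
      exact ⟨hB.1.inter hB'.1, ne_top_of_le_ne_top hB.2 (measure_mono inter_subset_left)⟩
  · rw [← prod_iUnion, iUnion_spanningSets, univ_prod_univ]
  · exact fun i => ⟨univ, h𝒞u, _, hspan i, rfl⟩
  · intro i
    rw [key _ h𝒞u _ (hspan i), Measure.map_apply hphi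
      (MeasurableSet.univ.prod (measurableSet_spanningSets ν i))]
    have : (fun x : Measure 𝓦 × 𝓦 => (x.1 + Measure.dirac x.2, x.2)) ⁻¹' (univ ×ˢ spanningSets ν i) =
        univ ×ˢ spanningSets ν i := by ext; simp
    rw [this, Measure.prod_prod]
    exact ENNReal.mul_ne_top (measure_ne_top _ _) (measure_spanningSets_lt_top ν i).ne
  · rintro _ ⟨E, hE, B, hB, rfl⟩
    exact key E hE B hB

/-- The Mecke equation. -/
theorem mecke [SigmaFinite ν] [IsProbabilityMeasure Pr] (hN : IsPoissonRandomMeasure N ν Pr)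
    {f : Measure 𝓦 → 𝓦 → ℝ≥0∞} (hf : Measurable (uncurry f)) :
    ∫⁻ M, ∫⁻ w, f M w ∂(evalKernel ν M) ∂(Pr.map N) =
      ∫⁻ w, ∫⁻ M, f (M + Measure.dirac w) w ∂(Pr.map N) ∂ν := by
  have : IsProbabilityMeasure (Pr.map N) :=
    Measure.isProbabilityMeasure_map hN.measurable.aemeasurable
  have hphi : Measurable fun x : Measure 𝓦 × 𝓦 => (x.1 + Measure.dirac x.2, x.2) :=
    measurable_add_dirac.prodMk measurable_snd
  have h := congrArg (fun μ => ∫⁻ x, uncurry f x ∂μ) hN.compProd_evalKernel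
  beta_reduce at h
  rw [Measure.lintegral_compProd hf, lintegral_map hf hphi,
    lintegral_prod_symm' _ (by exact hf.comp hphi)] at h
  exact h

end IsPoissonRandomMeasure

end Mecke

section Combinatorics

variable {𝓦 : Type*} {n : ℕ}

theorem finpartition_ext_part {p q : Finpartition (Finset.univ : Finset (Fin n))}
    (h : ∀ i j, p.part i = p.part j ↔ q.part i = q.part j) : p = q := by
  have hpart : ∀ i, p.part i = q.part i := fun i => by
    ext j
    rw [p.mem_part_iff_part_eq_part (Finset.mem_univ j) (Finset.mem_univ i),
      q.mem_part_iff_part_eq_part (Finset.mem_univ j) (Finset.mem_univ i), h]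
  have himg : ∀ r : Finpartition (Finset.univ : Finset (Fin n)),
      ∀ t, t ∈ r.parts ↔ ∃ i, r.part i = t := fun r t => by
    constructor
    · intro ht
      obtain ⟨i, -, hi⟩ := r.part_surjOn ht
      exact ⟨i, hi⟩
    · rintro ⟨i, rfl⟩
      exact r.part_mem.2 (Finset.mem_univ i)
  ext t
  rw [himg, himg]
  simp [hpart]

theorem part_tiePartition_eq_iff (w : Fin n → 𝓦) (i j : Fin n) :
    (tiePartition w).part i = (tiePartition w).part j ↔ w i = w j := by
  classical
  rw [← (tiePartition w).mem_part_iff_part_eq_part (Finset.mem_univ i) (Finset.mem_univ j)]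
  unfold tiePartition
  convert Finpartition.mem_part_ofSetoid_iff_rel (s := Setoid.ker w) using 1
  rw [Setoid.ker_def, eq_comm]

theorem tiePartition_eq_iff {w : Fin n → 𝓦} {p : Finpartition (Finset.univ : Finset (Fin n))} :
    tiePartition w = p ↔ ∀ i j, w i = w j ↔ p.part i = p.part j := by
  constructor
  · rintro rfl i j
    exact (part_tiePartition_eq_iff w i j).symm
  · intro h
    exact finpartition_ext_part fun i j => by rw [part_tiePartition_eq_iff, h]

variable (p : Finpartition (Finset.univ : Finset (Fin n)))

theorem exists_part_eq (C : p.parts) : ∃ i, p.part i = C :=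
  let ⟨i, _, hi⟩ := p.part_surjOn C.2
  ⟨i, hi⟩

/-- An index in a given cell of a partition. -/
noncomputable def cellIndex (C : p.parts) : Fin n := (exists_part_eq p C).choose

theorem part_cellIndex (C : p.parts) : p.part (cellIndex p C) = C :=
  (exists_part_eq p C).choose_spec

theorem assemble_cellIndex (v : p.parts → 𝓦) (C : p.parts) :
    assemble p v (cellIndex p C) = v C := by
  simp only [assemble, part_cellIndex]

theorem assemble_injective : Injective (assemble (𝓦 := 𝓦) p) := fun v v' h => by
  funext C
  rw [← assemble_cellIndex p v C, h, assemble_cellIndex]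

theorem tiePartition_assemble_eq_iff {v : p.parts → 𝓦} :
    tiePartition (assemble p v) = p ↔ Injective v := by
  rw [tiePartition_eq_iff]
  constructor
  · intro h C D hCD
    rw [← assemble_cellIndex p v C, ← assemble_cellIndex p v D, h, part_cellIndex,
      part_cellIndex] at hCD
    exact Subtype.ext hCD
  · intro hv i j
    simp only [assemble, hv.eq_iff, Subtype.mk.injEq]

theorem assemble_of_tiePartition_eq {w : Fin n → 𝓦} (hw : tiePartition w = p) :
    assemble p (fun C => w (cellIndex p C)) = w := by
  funext i
  rw [tiePartition_eq_iff] at hw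
  simp only [assemble]
  rw [hw, part_cellIndex]

theorem range_assemble (v : p.parts → 𝓦) : range (assemble p v) = range v := by
  ext x
  constructor
  · rintro ⟨i, rfl⟩; exact ⟨_, rfl⟩
  · rintro ⟨C, rfl⟩; exact ⟨_, assemble_cellIndex p v C⟩

theorem sum_distinctValues_assemble {M : Type*} [AddCommMonoid M] {v : p.parts → 𝓦}
    (hv : Injective v) (F : 𝓦 → M) :
    ∑ x ∈ distinctValues (assemble p v), F x = ∑ C, F (v C) := by
  classical
  have : distinctValues (assemble p v) = Finset.univ.image v := by
    ext x
    have := Set.ext_iff.1 (range_assemble p v) x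
    simpa [distinctValues] using this
  rw [this, Finset.sum_image fun a _ b _ h => hv h]

open Classical in
theorem sum_distinctValues {M : Type*} [AddCommMonoid M] (w : Fin n → 𝓦) (F : 𝓦 → M) :
    ∑ x ∈ distinctValues w, F x = ∑ i, if ∀ j < i, w j ≠ w i then F (w i) else 0 := by
  rw [← Finset.sum_filter]
  have hinj : Set.InjOn w (Finset.univ.filter fun i => ∀ j < i, w j ≠ w i : Finset (Fin n)) := by
    intro a ha b hb hab
    simp only [Finset.coe_filter, Finset.mem_univ, true_and] at ha hb
    rcases lt_trichotomy a b with h | h | h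
    · exact absurd hab (hb a h)
    · exact h
    · exact absurd hab.symm (ha b h)
  have himg : distinctValues w =
      (Finset.univ.filter fun i => ∀ j < i, w j ≠ w i).image w := by
    ext x
    simp only [distinctValues, Finset.mem_image, Finset.mem_univ, true_and, Finset.mem_filter]
    constructor
    · rintro ⟨i, rfl⟩
      have hne : (Finset.univ.filter fun j => w j = w i).Nonempty := ⟨i, by simp⟩
      have hmin := Finset.min'_mem _ hne
      simp only [Finset.mem_filter, Finset.mem_univ, true_and] at hmin
      refine ⟨_, fun j hj h => ?_, hmin⟩
      exact absurd (Finset.min'_le _ j (by simpa [hmin] using h)) (not_le.2 hj)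
    · rintro ⟨i, -, rfl⟩; exact ⟨i, rfl⟩
  rw [himg, Finset.sum_image hinj]

theorem exists_perm_of_cellSizes_eq {p q : Finpartition (Finset.univ : Finset (Fin n))}
    (h : cellSizes p = cellSizes q) :
    ∃ σ : Equiv.Perm (Fin n), ∀ i j, p.part i = p.part j ↔ q.part (σ i) = q.part (σ j) := by
  have hcount : ∀ (r : Finpartition (Finset.univ : Finset (Fin n))) (c : ℕ),
      Fintype.card {C : r.parts // C.1.card = c} = (cellSizes r).count c := fun r c => by
    rw [cellSizes, Multiset.count_map, Fintype.card_congr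
      (Equiv.subtypeSubtypeEquivSubtypeInter (· ∈ r.parts) fun C => C.card = c),
      Fintype.card_subtype, ← Finset.filter_val, Finset.card_val]
    congr 1
    ext C
    simp [eq_comm]
  let τ : p.parts ≃ q.parts := Equiv.ofFiberEquiv (f := fun C => C.1.card)
    (g := fun C => C.1.card) fun c => Fintype.equivOfCardEq (by rw [hcount, hcount, h])
  have hτ : ∀ C : p.parts, Nonempty (C.1 ≃ (τ C).1) := fun C =>
    ⟨Fintype.equivOfCardEq (by
      rw [Fintype.card_coe, Fintype.card_coe]
      exact (Equiv.ofFiberEquiv_map (f := fun C : p.parts => C.1.card)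
        (g := fun C : q.parts => C.1.card) _ C).symm)⟩
  let E : (Σ t : p.parts, t.1) ≃ Σ t : q.parts, t.1 := Equiv.sigmaCongr τ fun C => (hτ C).some
  let u : Fin n ≃ (Finset.univ : Finset (Fin n)) :=
    ⟨fun i => ⟨i, Finset.mem_univ i⟩, fun i => i.1, fun _ => rfl, fun _ => rfl⟩
  let σ : Equiv.Perm (Fin n) :=
    u.trans (p.equivSigmaParts.trans (E.trans (q.equivSigmaParts.symm.trans u.symm)))
  have hσ : ∀ i, q.part (σ i) = τ ⟨p.part i, p.part_mem.2 (Finset.mem_univ i)⟩ := fun i => by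
    refine q.part_eq_of_mem (Subtype.coe_prop _) ?_
    exact (E (p.equivSigmaParts (u i))).2.2
  refine ⟨σ, fun i j => ?_⟩
  rw [hσ, hσ, Subtype.coe_inj, τ.injective.eq_iff, Subtype.mk.injEq]

end Combinatorics

section Measurability

variable {𝓦 : Type*} [MeasurableSpace 𝓦] {n : ℕ}

theorem measurable_assemble (p : Finpartition (Finset.univ : Finset (Fin n))) :
    Measurable (assemble (𝓦 := 𝓦) p) :=
  measurable_pi_lambda _ fun _ => measurable_pi_apply _

theorem measurable_add_sum_dirac {ι : Type*} [Fintype ι] :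
    Measurable fun x : Measure 𝓦 × (ι → 𝓦) => x.1 + ∑ i, Measure.dirac (x.2 i) := by
  refine Measure.measurable_of_measurable_coe _ fun s hs => ?_
  simp only [Measure.add_apply, Measure.finsetSum_apply]
  refine ((Measure.measurable_coe hs).comp measurable_fst).add ?_
  exact Finset.measurable_fun_sum _ fun i _ =>
    ((Measure.measurable_coe hs).comp Measure.measurable_dirac).comp
      ((measurable_pi_apply i).comp measurable_snd)

theorem likelihood_eq_prod (h : 𝓦 × Measure 𝓦 → ℝ≥0) (w : Fin n → 𝓦) (M : Measure 𝓦) :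
    likelihood h w M = ∏ i, (h (w i, starMeasure w M) : ℝ≥0∞) := by
  classical
  have := Finset.prod_comp (s := Finset.univ)
    (fun v => (h (v, starMeasure w M) : ℝ≥0∞)) w
  rw [this]
  rfl

theorem starMeasure_assemble {p : Finpartition (Finset.univ : Finset (Fin n))} {v : p.parts → 𝓦}
    (hv : Injective v) (M : Measure 𝓦) :
    starMeasure (assemble p v) M = M + ∑ C, Measure.dirac (v C) := by
  rw [starMeasure, sum_distinctValues_assemble p hv]

variable [MeasurableEq 𝓦]

theorem measurableSet_tiePartition_eq (p : Finpartition (Finset.univ : Finset (Fin n))) :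
    MeasurableSet {w : Fin n → 𝓦 | tiePartition w = p} := by
  simp only [tiePartition_eq_iff, ofPred_forall]
  refine MeasurableSet.iInter fun i => MeasurableSet.iInter fun j => ?_
  by_cases h : p.part i = p.part j
  · simpa only [h, iff_true] using
      measurableSet_eq_fun (measurable_pi_apply i) (measurable_pi_apply j)
  · simp only [h, iff_false]
    exact (measurableSet_eq_fun (measurable_pi_apply i) (measurable_pi_apply j)).compl

theorem measurableSet_injective {ι : Type*} [Countable ι] :
    MeasurableSet {v : ι → 𝓦 | Injective v} := by
  simp only [Injective, ofPred_forall]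
  refine MeasurableSet.iInter fun i => MeasurableSet.iInter fun j => ?_
  by_cases h : i = j
  · simp [h]
  · simp only [h, imp_false]
    exact (measurableSet_eq_fun (measurable_pi_apply i) (measurable_pi_apply j)).compl

theorem measurable_starMeasure :
    Measurable fun x : Measure 𝓦 × (Fin n → 𝓦) => starMeasure x.2 x.1 := by
  classical
  refine Measure.measurable_of_measurable_coe _ fun s hs => ?_
  simp only [starMeasure, Measure.add_apply, Measure.finsetSum_apply,
    sum_distinctValues (F := fun v => Measure.dirac v s)]
  refine ((Measure.measurable_coe hs).comp measurable_fst).add ?_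
  refine Finset.measurable_fun_sum _ fun i _ => Measurable.ite ?_
    (((Measure.measurable_coe hs).comp Measure.measurable_dirac).comp
      ((measurable_pi_apply i).comp measurable_snd)) measurable_const
  simp only [ofPred_forall]
  exact MeasurableSet.iInter fun j => MeasurableSet.iInter fun _ =>
    (measurableSet_eq_fun ((measurable_pi_apply j).comp measurable_snd)
      ((measurable_pi_apply i).comp measurable_snd)).compl

theorem measurable_likelihood {h : 𝓦 × Measure 𝓦 → ℝ≥0} (hh : Measurable h) :
    Measurable fun x : Measure 𝓦 × (Fin n → 𝓦) => likelihood h x.2 x.1 := by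
  simp only [likelihood_eq_prod]
  refine Finset.measurable_fun_prod _ fun i _ => ?_
  exact (hh.comp (((measurable_pi_apply i).comp measurable_snd).prodMk
    measurable_starMeasure)).coe_nnreal_ennreal

theorem measurable_psi {h : 𝓦 × Measure 𝓦 → ℝ≥0} (hh : Measurable h)
    (Q : Measure (Measure 𝓦)) [SFinite Q] : Measurable (psi (n := n) h Q) :=
  (measurable_likelihood hh).lintegral_prod_left'

end Measurability

section Power

variable {α 𝓦 : Type*} [MeasurableSpace α] [MeasurableSpace 𝓦]

theorem measurable_finCons {m : ℕ} :
    Measurable fun x : 𝓦 × (Fin m → 𝓦) => (Fin.cons x.1 x.2 : Fin (m + 1) → 𝓦) := by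
  refine measurable_pi_lambda _ fun i => ?_
  refine Fin.cases ?_ (fun i => ?_) i
  · simpa using measurable_fst
  · simp only [Fin.cons_succ]
    exact (measurable_pi_apply i).comp measurable_snd

theorem pi_succ_eq_map (μ : Measure 𝓦) [SigmaFinite μ] (m : ℕ) :
    Measure.pi (fun _ : Fin (m + 1) => μ) =
      (μ.prod (Measure.pi fun _ : Fin m => μ)).map
        fun x => (Fin.cons x.1 x.2 : Fin (m + 1) → 𝓦) := by
  have h := (measurePreserving_piFinSuccAbove (fun _ : Fin (m + 1) => μ) 0).symm
  rw [← h.map_eq]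
  congr 1
  funext x
  exact Fin.insertNth_zero' x.1 x.2

theorem lintegral_pi_succ (μ : Measure 𝓦) [SigmaFinite μ] {m : ℕ} {f : (Fin (m + 1) → 𝓦) → ℝ≥0∞}
    (hf : Measurable f) :
    ∫⁻ v, f v ∂(Measure.pi fun _ : Fin (m + 1) => μ) =
      ∫⁻ v, ∫⁻ w, f (Fin.cons w v) ∂μ ∂(Measure.pi fun _ : Fin m => μ) := by
  rw [pi_succ_eq_map, lintegral_map hf measurable_finCons,
    lintegral_prod_symm' _ (by exact hf.comp measurable_finCons)]

theorem lintegral_pi_reindex (μ : Measure 𝓦) [SigmaFinite μ] {ι κ : Type*} [Fintype ι] [Fintype κ]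
    (e : ι ≃ κ) (f : (ι → 𝓦) → ℝ≥0∞) :
    ∫⁻ v, f v ∂(Measure.pi fun _ : ι => μ) =
      ∫⁻ v, f (fun i => v (e i)) ∂(Measure.pi fun _ : κ => μ) := by
  have h := (measurePreserving_piCongrLeft (fun _ : κ => μ) e).symm
  rw [← h.lintegral_comp_emb (MeasurableEquiv.measurableEmbedding _)]
  rfl

/-- The kernel of the `m`-fold product measures of a kernel. -/
noncomputable def powKernel (κ : Kernel α 𝓦) : ∀ m : ℕ, Kernel α (Fin m → 𝓦)
  | 0 => Kernel.const α (Measure.dirac Fin.elim0)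
  | m + 1 => (κ ×ₖ powKernel κ m).map fun x => (Fin.cons x.1 x.2 : Fin (m + 1) → 𝓦)

instance (κ : Kernel α 𝓦) [IsSFiniteKernel κ] (m : ℕ) : IsSFiniteKernel (powKernel κ m) := by
  induction m with
  | zero => unfold powKernel; infer_instance
  | succ m ih => unfold powKernel; infer_instance

theorem powKernel_apply (κ : Kernel α 𝓦) [IsSFiniteKernel κ] [∀ a, SigmaFinite (κ a)] (m : ℕ)
    (a : α) : powKernel κ m a = Measure.pi fun _ : Fin m => κ a := by
  induction m with
  | zero =>
    rw [Measure.pi_of_empty _ Fin.elim0]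
    rfl
  | succ m ih =>
    rw [powKernel, Kernel.map_apply _ measurable_finCons, Kernel.prod_apply, ih, pi_succ_eq_map]

theorem measurable_lintegral_pi_kernel (κ : Kernel α 𝓦) [IsSFiniteKernel κ]
    [∀ a, SigmaFinite (κ a)] {ι : Type*} [Fintype ι] {f : α → (ι → 𝓦) → ℝ≥0∞}
    (hf : Measurable (uncurry f)) :
    Measurable fun a => ∫⁻ v, f a v ∂(Measure.pi fun _ : ι => κ a) := by
  simp_rw [lintegral_pi_reindex _ (Fintype.equivFin ι), ← powKernel_apply]
  refine Measurable.lintegral_kernel_prod_right ?_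
  exact hf.comp (measurable_fst.prodMk (measurable_pi_lambda _ fun i =>
    (measurable_pi_apply _).comp measurable_snd))

variable [MeasurableEq 𝓦]

theorem ae_injective_pi (μ : Measure 𝓦) [SigmaFinite μ] [NullSingletonClass μ]
    (ι : Type*) [Fintype ι] :
    ∀ᵐ v ∂(Measure.pi fun _ : ι => μ), Injective v := by
  have hfin : ∀ m : ℕ, ∀ᵐ v ∂(Measure.pi fun _ : Fin m => μ), Injective v := by
    intro m
    induction m with
    | zero => exact ae_of_all _ fun v i => i.elim0
    | succ m ih =>
      have hm : MeasurableSet {v : Fin (m + 1) → 𝓦 | ¬ Injective v} :=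
        measurableSet_injective.compl
      rw [ae_iff, ← lintegral_indicator_one hm, lintegral_pi_succ _ (measurable_one.indicator hm),
        lintegral_eq_zero_iff' ?_]
      · filter_upwards [ih] with v hv
        refine (lintegral_eq_zero_iff ?_).2 ?_
        · exact (measurable_one.indicator hm).comp (measurable_finCons.comp
            (measurable_id.prodMk measurable_const))
        · have hr : μ (range v) = 0 := (finite_range v).measure_zero μ
          filter_upwards [measure_eq_zero_iff_ae_notMem.1 hr] with w hw
          refine indicator_of_notMem ?_ _
          simpa using Fin.cons_injective_iff.2 ⟨hw, hv⟩
      · have : Measurable fun x : (Fin m → 𝓦) × 𝓦 =>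
            {v : Fin (m + 1) → 𝓦 | ¬ Injective v}.indicator (1 : (Fin (m + 1) → 𝓦) → ℝ≥0∞) (Fin.cons x.2 x.1) :=
          (measurable_one.indicator hm).comp (measurable_finCons.comp measurable_swap)
        exact this.lintegral_prod_right'.aemeasurable
  have hm : MeasurableSet {v : ι → 𝓦 | ¬ Injective v} := measurableSet_injective.compl
  rw [ae_iff, ← lintegral_indicator_one hm, lintegral_pi_reindex μ (Fintype.equivFin ι)]
  refine (lintegral_eq_zero_iff' ?_).2 ?_
  · exact ((measurable_one.indicator hm).comp (measurable_pi_lambda _ fun i =>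
      measurable_pi_apply _)).aemeasurable
  · filter_upwards [hfin (Fintype.card ι)] with v hv
    refine indicator_of_notMem ?_ _
    exact not_not.2 (hv.comp (Fintype.equivFin ι).injective)

end Power

section Simple

variable {𝓦 : Type*} [MeasurableSpace 𝓦] [MeasurableSingletonClass 𝓦] {M : Measure 𝓦}

/-- A σ-finite measure has at most countably many atoms of mass one. -/
theorem countable_setOf_singleton_eq_one [SigmaFinite M] : {w | M {w} = 1}.Countable := by
  refine (Measure.countable_meas_pos_of_disjoint_iUnion (μ := M) (As := fun w : 𝓦 => {w})
    (fun w => measurableSet_singleton w) fun a b hab => by simpa using hab).mono fun w hw => ?_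
  have : M {w} = 1 := hw
  simp [this]

theorem lintegral_pi_eq_tsum [SigmaFinite M] (hM : ∀ᵐ w ∂M, M {w} = 1) {ι : Type*} [Fintype ι]
    (f : (ι → 𝓦) → ℝ≥0∞) :
    ∫⁻ v, f v ∂(Measure.pi fun _ : ι => M) =
      ∑' v : ι → 𝓦, {v : ι → 𝓦 | ∀ i, M {v i} = 1}.indicator f v := by
  have hc : {v : ι → 𝓦 | ∀ i, M {v i} = 1}.Countable :=
    Set.countable_pi fun _ => countable_setOf_singleton_eq_one
  have hae : ∀ᵐ v ∂(Measure.pi fun _ : ι => M), v ∈ {v : ι → 𝓦 | ∀ i, M {v i} = 1} :=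
    ae_all_iff.2 fun i => (Measure.tendsto_eval_ae_ae (μ := fun _ : ι => M) (i := i)).eventually hM
  rw [← tsum_subtype, ← setLIntegral_univ, ← setLIntegral_congr ((Filter.eventuallyEq_univ
      (s := {v : ι → 𝓦 | ∀ i, M {v i} = 1})).2 hae),
    lintegral_countable _ hc]
  refine tsum_congr fun v => ?_
  rw [Measure.pi_singleton, Finset.prod_eq_one fun i _ => v.2 i, mul_one]

theorem lintegral_pi_tiePartition_eq [SigmaFinite M] (hM : ∀ᵐ w ∂M, M {w} = 1) {n : ℕ}
    (p : Finpartition (Finset.univ : Finset (Fin n))) (f : (Fin n → 𝓦) → ℝ≥0∞) :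
    ∫⁻ w, {w | tiePartition w = p}.indicator f w ∂(Measure.pi fun _ : Fin n => M) =
      ∫⁻ v, {v | Injective v}.indicator (fun v => f (assemble p v)) v
        ∂(Measure.pi fun _ : p.parts => M) := by
  rw [lintegral_pi_eq_tsum hM, lintegral_pi_eq_tsum hM, ← (assemble_injective p).tsum_eq]
  · refine tsum_congr fun v => ?_
    have h1 : (∀ i, M {assemble p v i} = 1) ↔ ∀ C, M {v C} = 1 := by
      have := forall_mem_range (f := assemble p v) (p := fun x => M {x} = 1)
      rw [range_assemble, forall_mem_range] at this
      exact this.symm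
    have h2 := tiePartition_assemble_eq_iff (𝓦 := 𝓦) p (v := v)
    classical
    simp only [indicator_apply, mem_ofPred_eq, h1, h2]
  · intro w hw
    have hw' : tiePartition w = p := by
      by_contra h
      refine hw ?_
      classical
      simp only [indicator_apply, mem_ofPred_eq, h, if_false, ite_self]
    exact ⟨_, assemble_of_tiePartition_eq p hw'⟩

end Simple

section PowerMecke

variable {Ω 𝓦 : Type*} [MeasurableSpace Ω] [MeasurableSpace 𝓦] {Pr : Measure Ω}
  {ν : Measure 𝓦} {N : Ω → Measure 𝓦}

instance isFiniteMeasure_sum_dirac {ι : Type*} (s : Finset ι) (v : ι → 𝓦) :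
    IsFiniteMeasure (∑ i ∈ s, Measure.dirac (v i)) :=
  ⟨by simp [Measure.finsetSum_apply]⟩

theorem starMeasure_mem_locallyFinite [SigmaFinite ν] {n : ℕ} (w : Fin n → 𝓦) {M : Measure 𝓦}
    (hM : M ∈ locallyFinite ν) : starMeasure w M ∈ locallyFinite ν :=
  add_mem_locallyFinite hM

theorem IsPoissonRandomMeasure.ae_singleton_eq_zero [SigmaFinite ν] [NullSingletonClass ν]
    [IsProbabilityMeasure Pr] [MeasurableSingletonClass 𝓦] (hN : IsPoissonRandomMeasure N ν Pr)
    (w : 𝓦) : ∀ᵐ M ∂(Pr.map N), M {w} = 0 := by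
  have h := hN.mecke (f := fun _ x => ({w} : Set 𝓦).indicator 1 x)
    ((measurable_one.indicator (measurableSet_singleton w)).comp measurable_snd)
  have h0 : ∫⁻ x, ∫⁻ _, ({w} : Set 𝓦).indicator (1 : 𝓦 → ℝ≥0∞) x ∂(Pr.map N) ∂ν = 0 := by
    rw [lintegral_congr_ae (g := fun _ => 0), lintegral_zero]
    filter_upwards [measure_eq_zero_iff_ae_notMem.1 (measure_singleton (μ := ν) w)] with x hx
    simp only [indicator_of_notMem hx, lintegral_zero]
  simp only [h0, lintegral_indicator_one (measurableSet_singleton w)] at h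
  rw [lintegral_eq_zero_iff (Kernel.measurable_coe _ (measurableSet_singleton w))] at h
  filter_upwards [h, hN.ae_map_mem_locallyFinite] with M hM hM'
  rwa [evalKernel_apply_of_mem hM'] at hM

variable [MeasurableEq 𝓦]

theorem measurable_evalKernel_singleton (ν : Measure 𝓦) [SigmaFinite ν] :
    Measurable fun x : Measure 𝓦 × 𝓦 => evalKernel ν x.1 {x.2} := by
  have ht : MeasurableSet {x : (Measure 𝓦 × 𝓦) × 𝓦 | x.2 = x.1.2} :=
    measurableSet_eq_fun measurable_snd (measurable_snd.comp measurable_fst)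
  have := Kernel.measurable_kernel_prodMk_left
    (κ := (evalKernel ν).comap (Prod.fst : Measure 𝓦 × 𝓦 → Measure 𝓦) measurable_fst) ht
  exact this

namespace IsPoissonRandomMeasure

variable [SigmaFinite ν] [IsProbabilityMeasure Pr]

theorem ae_ae_singleton_eq_one [NullSingletonClass ν] [MeasurableSingletonClass 𝓦]
    (hN : IsPoissonRandomMeasure N ν Pr) : ∀ᵐ M ∂(Pr.map N), ∀ᵐ w ∂M, M {w} = 1 := by
  set S : Set (Measure 𝓦 × 𝓦) := {x | evalKernel ν x.1 {x.2} ≠ 1} with hS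
  have hSm : MeasurableSet S :=
    (measurable_evalKernel_singleton ν (measurableSet_singleton 1)).compl
  have hf : Measurable (uncurry fun M w => S.indicator (1 : Measure 𝓦 × 𝓦 → ℝ≥0∞) (M, w)) :=
    measurable_one.indicator hSm
  have h := hN.mecke hf
  have h0 : ∀ w, ∫⁻ M, S.indicator (1 : Measure 𝓦 × 𝓦 → ℝ≥0∞) (M + Measure.dirac w, w)
      ∂(Pr.map N) = 0 := fun w => by
    rw [lintegral_congr_ae (g := fun _ => 0), lintegral_zero]
    filter_upwards [hN.ae_singleton_eq_zero w, hN.ae_map_mem_locallyFinite] with M hM hM'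
    refine indicator_of_notMem ?_ _
    simp [hS, evalKernel_apply_of_mem (add_mem_locallyFinite hM'), hM]
  simp only [h0, lintegral_zero] at h
  rw [lintegral_eq_zero_iff (hf.lintegral_kernel_prod_right)] at h
  filter_upwards [h, hN.ae_map_mem_locallyFinite] with M hM hM'
  have hm : Measurable fun w => S.indicator (1 : Measure 𝓦 × 𝓦 → ℝ≥0∞) (M, w) :=
    hf.comp (measurable_const.prodMk measurable_id)
  rw [Pi.zero_apply, lintegral_eq_zero_iff hm, evalKernel_apply_of_mem hM'] at hM
  filter_upwards [hM] with w hw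
  by_contra hne
  have : (M, w) ∈ S := by simpa [hS, evalKernel_apply_of_mem hM'] using hne
  simp [indicator_of_mem this] at hw

theorem mecke_injective_fin (hN : IsPoissonRandomMeasure N ν Pr) (m : ℕ)
    {f : Measure 𝓦 → (Fin m → 𝓦) → ℝ≥0∞} (hf : Measurable (uncurry f)) :
    ∫⁻ M, ∫⁻ v, {v | Injective v}.indicator (f M) v
        ∂(Measure.pi fun _ : Fin m => evalKernel ν M) ∂(Pr.map N) =
      ∫⁻ v, {v | Injective v}.indicator
        (fun v => ∫⁻ M, f (M + ∑ i, Measure.dirac (v i)) v ∂(Pr.map N)) v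
        ∂(Measure.pi fun _ : Fin m => ν) := by
  classical
  have : IsProbabilityMeasure (Pr.map N) :=
    Measure.isProbabilityMeasure_map hN.measurable.aemeasurable
  induction m with
  | zero =>
    have hinj : ∀ v : Fin 0 → 𝓦, Injective v := fun v i => i.elim0
    simp [Measure.pi_of_empty _ Fin.elim0, hinj]
  | succ m ih =>
    -- the integrand in the last point `w`, for `w` not among the points of `v`
    let g : Measure 𝓦 → (Fin m → 𝓦) → 𝓦 → ℝ≥0∞ := fun M v w =>
      {x : (Fin m → 𝓦) × 𝓦 | x.2 ∉ range x.1}.indicator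
        (fun x => f M (Fin.cons x.2 x.1)) (v, w)
    have hset : MeasurableSet {x : (Fin m → 𝓦) × 𝓦 | x.2 ∉ range x.1} := by
      simp only [mem_range, not_exists, ofPred_forall]
      exact MeasurableSet.iInter fun i => (measurableSet_eq_fun
        ((measurable_pi_apply i).comp measurable_fst) measurable_snd).compl
    have hcons : Measurable fun x : (Fin m → 𝓦) × 𝓦 => (Fin.cons x.2 x.1 : Fin (m + 1) → 𝓦) :=
      measurable_finCons.comp measurable_swap
    have hg : Measurable fun x : (Measure 𝓦 × (Fin m → 𝓦)) × 𝓦 => g x.1.1 x.1.2 x.2 := by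
      have hp : Measurable fun x : (Measure 𝓦 × (Fin m → 𝓦)) × 𝓦 => (x.1.2, x.2) :=
        (measurable_snd.comp measurable_fst).prodMk measurable_snd
      have : (fun x : (Measure 𝓦 × (Fin m → 𝓦)) × 𝓦 => g x.1.1 x.1.2 x.2) =
          ((fun x : (Measure 𝓦 × (Fin m → 𝓦)) × 𝓦 => (x.1.2, x.2)) ⁻¹'
            {x : (Fin m → 𝓦) × 𝓦 | x.2 ∉ range x.1}).indicator
            fun x => f x.1.1 (Fin.cons x.2 x.1.2) := by
        funext x
        simp only [g, indicator_apply, mem_preimage]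
      rw [this]
      exact Measurable.indicator (hf.comp
        ((measurable_fst.comp measurable_fst).prodMk (hcons.comp hp))) (hp hset)
    have hind : ∀ (F : (Fin (m + 1) → 𝓦) → ℝ≥0∞) v w,
        {v | Injective v}.indicator F (Fin.cons w v) =
        {v | Injective v}.indicator (fun v =>
          {x : (Fin m → 𝓦) × 𝓦 | x.2 ∉ range x.1}.indicator
            (fun x => F (Fin.cons x.2 x.1)) (v, w)) v := fun F v w => by
      simp only [indicator_apply, mem_ofPred_eq, Fin.cons_injective_iff]
      by_cases h1 : w ∈ range v <;> by_cases h2 : Injective v <;> simp [h1, h2]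
    have hG : Measurable (uncurry fun M v => ∫⁻ w, g M v w ∂(evalKernel ν M)) := by
      have := Measurable.lintegral_kernel_prod_right (κ := (evalKernel ν).comap
        (Prod.fst : Measure 𝓦 × (Fin m → 𝓦) → Measure 𝓦) measurable_fst)
        (f := fun x w => g x.1 x.2 w) hg
      exact this
    have hL : ∀ M : Measure 𝓦, ∫⁻ v, {v | Injective v}.indicator (f M) v
          ∂(Measure.pi fun _ : Fin (m + 1) => evalKernel ν M) =
        ∫⁻ v, {v | Injective v}.indicator (fun v => ∫⁻ w, g M v w ∂(evalKernel ν M)) v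
          ∂(Measure.pi fun _ : Fin m => evalKernel ν M) := fun M => by
      have hfM : Measurable (f M) := hf.comp (measurable_const.prodMk measurable_id)
      rw [lintegral_pi_succ _ (hfM.indicator measurableSet_injective)]
      refine lintegral_congr fun v => ?_
      simp only [hind]
      by_cases hv : Injective v <;> simp [hv, g]
    have hR : Measurable fun v : Fin (m + 1) → 𝓦 =>
        ∫⁻ M, f (M + ∑ i, Measure.dirac (v i)) v ∂(Pr.map N) := by
      have : Measurable fun x : Measure 𝓦 × (Fin (m + 1) → 𝓦) =>
          f (x.1 + ∑ i, Measure.dirac (x.2 i)) x.2 :=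
        hf.comp (measurable_add_sum_dirac.prodMk measurable_snd)
      exact this.lintegral_prod_left'
    simp_rw [hL]
    rw [ih hG, lintegral_pi_succ _ (hR.indicator measurableSet_injective)]
    refine lintegral_congr fun v => ?_
    simp only [hind]
    by_cases hv : Injective v
    swap
    · simp [hv]
    have hvm : v ∈ {v : Fin m → 𝓦 | Injective v} := hv
    simp only [indicator_of_mem hvm]
    have hadd : Measurable fun M : Measure 𝓦 => M + ∑ i, Measure.dirac (v i) :=
      measurable_add_sum_dirac.comp (measurable_id.prodMk measurable_const)
    have hg' : Measurable (uncurry fun M w => g (M + ∑ i, Measure.dirac (v i)) v w) :=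
      hg.comp (((hadd.comp measurable_fst).prodMk measurable_const).prodMk measurable_snd)
    have hmecke := hN.mecke hg'
    calc ∫⁻ M, ∫⁻ w, g (M + ∑ i, Measure.dirac (v i)) v w
            ∂(evalKernel ν (M + ∑ i, Measure.dirac (v i))) ∂(Pr.map N)
        = ∫⁻ M, ∫⁻ w, g (M + ∑ i, Measure.dirac (v i)) v w ∂(evalKernel ν M) ∂(Pr.map N) := by
          refine lintegral_congr_ae ?_
          filter_upwards [hN.ae_map_mem_locallyFinite] with M hM
          have hgm : Measurable fun w => g (M + ∑ i, Measure.dirac (v i)) v w := by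
            have hM' : Measurable fun w : 𝓦 => ((M + ∑ i, Measure.dirac (v i), v), w) :=
              measurable_const.prodMk measurable_id
            exact hg.comp hM'
          have h0 : ∑ i, ∫⁻ w, g (M + ∑ i, Measure.dirac (v i)) v w ∂(Measure.dirac (v i)) = 0 :=
            Finset.sum_eq_zero fun i _ => by
              rw [lintegral_dirac' _ hgm]
              exact indicator_of_notMem (by simp) _
          rw [evalKernel_apply_of_mem (add_mem_locallyFinite hM), evalKernel_apply_of_mem hM,
            lintegral_add_measure, lintegral_finsetSum_measure, h0, add_zero]
      _ = _ := hmecke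
      _ = _ := by
          refine lintegral_congr fun w => ?_
          by_cases hw : w ∈ range v
          · have : (v, w) ∉ {x : (Fin m → 𝓦) × 𝓦 | x.2 ∉ range x.1} := fun h => h hw
            simp only [g, indicator_of_notMem this, lintegral_zero]
          · have : (v, w) ∈ {x : (Fin m → 𝓦) × 𝓦 | x.2 ∉ range x.1} := hw
            simp only [g, indicator_of_mem this, Fin.sum_univ_succ, Fin.cons_zero, Fin.cons_succ,
              add_assoc]

theorem mecke_injective [NullSingletonClass ν] (hN : IsPoissonRandomMeasure N ν Pr) {ι : Type*}
    [Fintype ι] {f : Measure 𝓦 → (ι → 𝓦) → ℝ≥0∞} (hf : Measurable (uncurry f)) :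
    ∫⁻ M, ∫⁻ v, {v | Injective v}.indicator (f M) v
        ∂(Measure.pi fun _ : ι => evalKernel ν M) ∂(Pr.map N) =
      ∫⁻ v, ∫⁻ M, f (M + ∑ i, Measure.dirac (v i)) v ∂(Pr.map N) ∂(Measure.pi fun _ : ι => ν) := by
  classical
  let e := Fintype.equivFin ι
  have hcomp : Measurable fun v : Fin (Fintype.card ι) → 𝓦 => fun i => v (e i) :=
    measurable_pi_lambda _ fun i => measurable_pi_apply _
  have h := hN.mecke_injective_fin (Fintype.card ι) (f := fun M v => f M fun i => v (e i))
    (hf.comp (measurable_fst.prodMk (hcomp.comp measurable_snd)))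
  have hinj : ∀ v : Fin (Fintype.card ι) → 𝓦, Injective (fun i => v (e i)) ↔ Injective v :=
    fun v => ⟨fun hv => by simpa [comp_def] using hv.comp e.symm.injective,
      fun hv => hv.comp e.injective⟩
  have hrhs : ∫⁻ v, ∫⁻ M, f (M + ∑ i, Measure.dirac (v i)) v ∂(Pr.map N)
        ∂(Measure.pi fun _ : ι => ν) =
      ∫⁻ v, {v | Injective v}.indicator
        (fun v => ∫⁻ M, f (M + ∑ i, Measure.dirac (v i)) v ∂(Pr.map N)) v
        ∂(Measure.pi fun _ : ι => ν) := by
    refine lintegral_congr_ae ?_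
    filter_upwards [ae_injective_pi ν ι] with v hv
    have hv' : v ∈ {v : ι → 𝓦 | Injective v} := hv
    rw [indicator_of_mem hv']
  rw [hrhs]
  simp_rw [lintegral_pi_reindex _ e]
  have hsum : ∀ v : Fin (Fintype.card ι) → 𝓦,
      ∑ i, Measure.dirac (v (e i)) = ∑ i, Measure.dirac (v i) := fun v =>
    e.sum_comp fun i => Measure.dirac (v i)
  simp only [indicator_apply, mem_ofPred_eq, hinj, hsum]
  simpa only [indicator_apply, mem_ofPred_eq] using h

/-- The Mecke equation for the powers of a Poisson random measure. -/
theorem mecke_pi [NullSingletonClass ν] [MeasurableSingletonClass 𝓦]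
    (hN : IsPoissonRandomMeasure N ν Pr) {n : ℕ}
    {f : Measure 𝓦 → (Fin n → 𝓦) → ℝ≥0∞} (hf : Measurable (uncurry f)) :
    ∫⁻ M, ∫⁻ w, f M w ∂(Measure.pi fun _ : Fin n => M) ∂(Pr.map N) =
      ∫⁻ w, ∫⁻ M, f (starMeasure w M) w ∂(Pr.map N) ∂(partitionMeasure ν n) := by
  classical
  have : IsProbabilityMeasure (Pr.map N) :=
    Measure.isProbabilityMeasure_map hN.measurable.aemeasurable
  have hR : Measurable fun w : Fin n → 𝓦 => ∫⁻ M, f (starMeasure w M) w ∂(Pr.map N) := by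
    have : Measurable fun x : Measure 𝓦 × (Fin n → 𝓦) => f (starMeasure x.2 x.1) x.2 :=
      hf.comp (measurable_starMeasure.prodMk measurable_snd)
    exact this.lintegral_prod_left'
  have hfp : ∀ p : Finpartition (Finset.univ : Finset (Fin n)),
      Measurable (uncurry fun M (v : p.parts → 𝓦) => f M (assemble p v)) := fun p =>
    hf.comp (measurable_fst.prodMk ((measurable_assemble p).comp measurable_snd))
  calc ∫⁻ M, ∫⁻ w, f M w ∂(Measure.pi fun _ : Fin n => M) ∂(Pr.map N)
      = ∫⁻ M, ∑ p : Finpartition (Finset.univ : Finset (Fin n)),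
          ∫⁻ v, {v | Injective v}.indicator (fun v => f M (assemble p v)) v
            ∂(Measure.pi fun _ : p.parts => evalKernel ν M) ∂(Pr.map N) := by
        refine lintegral_congr_ae ?_
        filter_upwards [hN.ae_ae_singleton_eq_one, hN.ae_map_mem_locallyFinite] with M hM hM'
        have := sigmaFinite_of_mem_locallyFinite hM'
        have hfM : Measurable (f M) := hf.comp (measurable_const.prodMk measurable_id)
        simp only [evalKernel_apply_of_mem hM', ← lintegral_pi_tiePartition_eq hM]
        rw [← lintegral_finsetSum _ fun p _ => hfM.indicator (measurableSet_tiePartition_eq p)]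
        refine lintegral_congr fun w => ?_
        simp [indicator_apply]
    _ = ∑ p : Finpartition (Finset.univ : Finset (Fin n)),
          ∫⁻ v, ∫⁻ M, f (M + ∑ i, Measure.dirac (v i)) (assemble p v) ∂(Pr.map N)
            ∂(Measure.pi fun _ : p.parts => ν) := by
        rw [lintegral_finsetSum]
        · exact Finset.sum_congr rfl fun p _ => hN.mecke_injective (hfp p)
        · intro p _
          refine measurable_lintegral_pi_kernel _ ?_
          exact (hfp p).indicator (measurable_snd measurableSet_injective)
    _ = _ := by
        rw [partitionMeasure, lintegral_finsetSum_measure]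
        refine Finset.sum_congr rfl fun p _ => ?_
        rw [lintegral_map hR (measurable_assemble p)]
        refine lintegral_congr_ae ?_
        filter_upwards [ae_injective_pi ν p.parts] with v hv
        simp only [starMeasure_assemble hv]

end IsPoissonRandomMeasure

end PowerMecke

section WithDensity

variable {𝓦 : Type*} [MeasurableSpace 𝓦]

theorem lintegral_pi_withDensity (μ : Measure 𝓦) [SigmaFinite μ] {g : 𝓦 → ℝ≥0∞}
    (hg : Measurable g) [SigmaFinite (μ.withDensity g)] {m : ℕ} {f : (Fin m → 𝓦) → ℝ≥0∞}
    (hf : Measurable f) :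
    ∫⁻ v, f v ∂(Measure.pi fun _ : Fin m => μ.withDensity g) =
      ∫⁻ v, (∏ i, g (v i)) * f v ∂(Measure.pi fun _ : Fin m => μ) := by
  induction m with
  | zero => simp [Measure.pi_of_empty _ Fin.elim0]
  | succ m ih =>
    have hcons : Measurable fun x : (Fin m → 𝓦) × 𝓦 => (Fin.cons x.2 x.1 : Fin (m + 1) → 𝓦) :=
      measurable_finCons.comp measurable_swap
    have hprod : ∀ k : ℕ, Measurable fun v : Fin k → 𝓦 => ∏ i, g (v i) := fun k =>
      Finset.measurable_fun_prod _ fun i _ => hg.comp (measurable_pi_apply i)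
    have hin : ∀ v : Fin m → 𝓦, Measurable fun w => f (Fin.cons w v) := fun v =>
      hf.comp (hcons.comp (measurable_const.prodMk measurable_id))
    have hout : Measurable fun v : Fin m → 𝓦 => ∫⁻ w, f (Fin.cons w v) ∂(μ.withDensity g) :=
      (hf.comp hcons).lintegral_prod_right'
    rw [lintegral_pi_succ _ hf, ih hout, lintegral_pi_succ _ (by exact (hprod _).mul hf)]
    refine lintegral_congr fun v => ?_
    rw [lintegral_withDensity_eq_lintegral_mul _ hg (hin v), ← lintegral_const_mul _
      (hg.mul (hin v))]
    refine lintegral_congr fun w => ?_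
    simp only [Pi.mul_apply, Fin.prod_univ_succ, Fin.cons_zero, Fin.cons_succ]
    ring

variable (ν : Measure 𝓦) [SigmaFinite ν]

/-- A measure is recovered from its density multiple by dividing by the masses of the atoms. -/
noncomputable def recoverKernel : Kernel (Measure 𝓦) 𝓦 :=
  (evalKernel ν).withDensity fun M w => (evalKernel ν M {w})⁻¹

variable {ν} in
theorem finite_mem_locallyFinite {M : Measure 𝓦} [IsFiniteMeasure M] : M ∈ locallyFinite ν :=
  fun _ => measure_lt_top _ _

variable {h : 𝓦 × Measure 𝓦 → ℝ≥0}

theorem measurable_weight (hh : Measurable h) (M : Measure 𝓦) :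
    Measurable fun w => (h (w, M) : ℝ≥0∞) :=
  (hh.comp (measurable_id.prodMk measurable_const)).coe_nnreal_ennreal

variable {ν} in
theorem recoverKernel_weighted [MeasurableEq 𝓦] [MeasurableSingletonClass 𝓦] (hh : Measurable h)
    (hpos : ∀ x, 0 < h x) {M : Measure 𝓦} (hM : ∀ᵐ w ∂M, M {w} = 1)
    [IsFiniteMeasure (weighted h M)] : recoverKernel ν (weighted h M) = M := by
  have hm := measurable_weight hh M
  rw [recoverKernel, Kernel.withDensity_apply _
    (by exact (measurable_evalKernel_singleton ν).inv),
    evalKernel_apply_of_mem finite_mem_locallyFinite]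
  have hw : ∀ᵐ w ∂(weighted h M), (weighted h M {w})⁻¹ = ((h (w, M) : ℝ≥0∞))⁻¹ := by
    refine (withDensity_absolutelyContinuous M _).ae_le ?_
    filter_upwards [hM] with w hw
    rw [weighted, withDensity_apply _ (measurableSet_singleton w), lintegral_singleton, hw, mul_one]
  rw [withDensity_congr_ae hw, weighted]
  exact withDensity_inv_same hm (ae_of_all _ fun w => by simpa using (hpos _).ne')
    (ae_of_all _ fun w => ENNReal.coe_ne_top)

/-- A measurable version of `weighted h`. -/
noncomputable def weightedKernel (h : 𝓦 × Measure 𝓦 → ℝ≥0) : Kernel (Measure 𝓦) 𝓦 :=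
  (evalKernel ν).withDensity fun M w => h (w, M)

variable {ν} in
theorem weightedKernel_apply (hh : Measurable h) {M : Measure 𝓦} (hM : M ∈ locallyFinite ν) :
    weightedKernel ν h M = weighted h M := by
  have hm : Measurable (uncurry fun (M : Measure 𝓦) (w : 𝓦) => (h (w, M) : ℝ≥0∞)) :=
    (hh.comp measurable_swap).coe_nnreal_ennreal
  rw [weightedKernel, Kernel.withDensity_apply _ hm, evalKernel_apply_of_mem hM, weighted]

theorem weighted_starMeasure (hh : Measurable h) {n : ℕ} (w : Fin n → 𝓦) (M : Measure 𝓦) :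
    weighted h (starMeasure w M) =
      M.withDensity (fun v => (h (v, starMeasure w M) : ℝ≥0∞)) +
        ∑ v ∈ distinctValues w, (h (v, starMeasure w M) : ℝ≥0∞) • Measure.dirac v := by
  have hm := measurable_weight hh (starMeasure w M)
  have hs : ∀ s : Finset 𝓦, (∑ v ∈ s, Measure.dirac v).withDensity
      (fun v => (h (v, starMeasure w M) : ℝ≥0∞)) =
      ∑ v ∈ s, (h (v, starMeasure w M) : ℝ≥0∞) • Measure.dirac v := fun s => by
    classical
    induction s using Finset.induction_on with
    | empty => simp
    | insert a s ha ih =>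
      rw [Finset.sum_insert ha, Finset.sum_insert ha, withDensity_add_measure, ih,
        dirac_withDensity' hm]
  rw [weighted, ← hs, ← withDensity_add_measure]
  rfl

end WithDensity

section Posterior

variable {𝓦 : Type*} [MeasurableSpace 𝓦] {n : ℕ} {h : 𝓦 × Measure 𝓦 → ℝ≥0}
  {Q : Measure (Measure 𝓦)}

theorem likelihood_ne_zero (hpos : ∀ x, 0 < h x) (w : Fin n → 𝓦) (M : Measure 𝓦) :
    likelihood h w M ≠ 0 := by
  rw [likelihood_eq_prod]
  exact Finset.prod_ne_zero_iff.2 fun i _ => by simpa using (hpos _).ne'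

theorem likelihood_ne_top (w : Fin n → 𝓦) (M : Measure 𝓦) : likelihood h w M ≠ ∞ := by
  rw [likelihood_eq_prod]
  exact ENNReal.prod_ne_top fun i _ => ENNReal.coe_ne_top

variable [MeasurableEq 𝓦]

theorem measurable_starMeasure_right (w : Fin n → 𝓦) : Measurable (starMeasure w) :=
  measurable_starMeasure.comp (measurable_id.prodMk measurable_const)

theorem measurable_likelihood_right (hh : Measurable h) (w : Fin n → 𝓦) :
    Measurable (likelihood h w) := by
  have hp : Measurable fun M : Measure 𝓦 => (M, w) := measurable_id.prodMk measurable_const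
  have := (measurable_likelihood (n := n) hh).comp hp
  simp only [comp_def] at this
  exact this

theorem psi_pos [NeZero Q] (hh : Measurable h) (hpos : ∀ x, 0 < h x) (w : Fin n → 𝓦) :
    0 < psi h Q w := by
  rw [pos_iff_ne_zero]
  intro h0
  rw [psi, lintegral_eq_zero_iff (measurable_likelihood_right hh w)] at h0
  have : ∀ᵐ _ ∂Q, False := by
    filter_upwards [h0] with M hM
    exact likelihood_ne_zero hpos w M hM
  exact NeZero.ne Q (by simpa using this)

theorem lintegral_map_piStar [NeZero Q] (hh : Measurable h) (hpos : ∀ x, 0 < h x) {w : Fin n → 𝓦}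
    (hw : psi h Q w ≠ ∞) {F : Measure 𝓦 → ℝ≥0∞} (hF : Measurable F) :
    psi h Q w * ∫⁻ M, F M ∂((piStar h Q w).map (starMeasure w)) =
      ∫⁻ M, likelihood h w M * F (starMeasure w M) ∂Q := by
  have hl := measurable_likelihood_right hh w
  have hs := measurable_starMeasure_right w
  rw [lintegral_map hF hs, piStar,
    lintegral_withDensity_eq_lintegral_mul _ (hl.const_mul _) (by exact hF.comp hs),
    ← lintegral_const_mul _ (by exact (hl.const_mul _).mul (hF.comp hs))]
  refine lintegral_congr fun M => ?_
  simp only [Pi.mul_apply]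
  rw [← mul_assoc, ← mul_assoc, ENNReal.mul_inv_cancel (psi_pos hh hpos w).ne' hw, one_mul]

theorem isProbabilityMeasure_map_piStar [NeZero Q] (hh : Measurable h) (hpos : ∀ x, 0 < h x)
    {w : Fin n → 𝓦} (hw : psi h Q w ≠ ∞) :
    IsProbabilityMeasure ((piStar h Q w).map (starMeasure w)) := by
  have := lintegral_map_piStar (F := fun _ => 1) hh hpos hw measurable_const
  simp only [lintegral_one, mul_one] at this
  constructor
  rw [← ENNReal.mul_right_inj (psi_pos hh hpos w).ne' hw, this, mul_one]
  rfl

theorem exists_kernel_map_piStar [IsProbabilityMeasure Q] (hh : Measurable h)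
    (hpos : ∀ x, 0 < h x) :
    ∃ κ : Kernel (Fin n → 𝓦) (Measure 𝓦), IsMarkovKernel κ ∧
      ∀ w, psi h Q w ≠ ∞ → κ w = (piStar h Q w).map (starMeasure w) := by
  classical
  have hpsi := measurable_psi (n := n) hh Q
  have hl := (measurable_likelihood (n := n) hh).comp measurable_swap
  simp only [comp_def, Prod.fst_swap, Prod.snd_swap] at hl
  have hd : Measurable (uncurry fun (w : Fin n → 𝓦) M => (psi h Q w)⁻¹ * likelihood h w M) := by
    have hp : Measurable fun x : (Fin n → 𝓦) × Measure 𝓦 => (psi h Q x.1)⁻¹ :=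
      hpsi.inv.comp measurable_fst
    exact hp.mul hl
  let κ₁ : Kernel (Fin n → 𝓦) (Measure 𝓦) :=
    (Kernel.const _ Q).withDensity fun w M => (psi h Q w)⁻¹ * likelihood h w M
  have hκ₁ : ∀ w, κ₁ w = piStar h Q w := fun w => by
    rw [Kernel.withDensity_apply _ hd, Kernel.const_apply]; rfl
  have : IsSFiniteKernel κ₁ := Kernel.IsSFiniteKernel.withDensity _ fun w M =>
    ENNReal.mul_ne_top (ENNReal.inv_ne_top.2 (psi_pos hh hpos w).ne') (likelihood_ne_top w M)
  let κ₂ : Kernel (Fin n → 𝓦) (Measure 𝓦) :=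
    (Kernel.id ×ₖ κ₁).map fun x => starMeasure x.1 x.2
  have hst : Measurable fun x : (Fin n → 𝓦) × Measure 𝓦 => starMeasure x.1 x.2 :=
    Measurable.comp (g := fun x : Measure 𝓦 × (Fin n → 𝓦) => starMeasure x.2 x.1)
      measurable_starMeasure measurable_swap
  have hκ₂ : ∀ w, κ₂ w = (piStar h Q w).map (starMeasure w) := fun w => by
    rw [Kernel.map_apply _ hst, Kernel.prod_apply, Kernel.id_apply, hκ₁]
    have : SFinite (piStar h Q w) := by rw [← hκ₁]; infer_instance
    rw [Measure.dirac_prod, Measure.map_map hst measurable_prodMk_left]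
    rfl
  have hset : MeasurableSet {w : Fin n → 𝓦 | psi h Q w ≠ ∞} :=
    hpsi (measurableSet_singleton ∞).compl
  refine ⟨Kernel.piecewise hset κ₂ (Kernel.const _ (Measure.dirac 0)), ⟨fun w => ?_⟩,
    fun w hw => ?_⟩
  · rw [Kernel.piecewise_apply]
    split_ifs with hw
    · rw [hκ₂]; exact isProbabilityMeasure_map_piStar hh hpos hw
    · rw [Kernel.const_apply]; infer_instance
  · rw [Kernel.piecewise_apply, if_pos (by exact hw), hκ₂]

end Posterior

section Sampling

variable {Ω 𝓦 : Type*} [MeasurableSpace Ω] [MeasurableSpace 𝓦] {Pr : Measure Ω}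
  {ν : Measure 𝓦} {N : Ω → Measure 𝓦} {h : 𝓦 × Measure 𝓦 → ℝ≥0} {n : ℕ} {W : Ω → Fin n → 𝓦}

theorem IsConditionalLaw.aemeasurable_left {𝓧 𝓨 : Type*} [MeasurableSpace 𝓧] [MeasurableSpace 𝓨]
    {Y : Ω → 𝓨} {X : Ω → 𝓧} {K : 𝓧 → Measure 𝓨} (hY : IsConditionalLaw Y X K Pr) :
    AEMeasurable Y Pr :=
  let ⟨_, _, _, hκ⟩ := hY
  hκ.aemeasurable_snd

theorem ae_isProbabilityMeasure_weighted
    (hprob : ∀ᵐ ω ∂Pr, ∫⁻ w, (h (w, N ω) : ℝ≥0∞) ∂(N ω) = 1) :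
    ∀ᵐ ω ∂Pr, IsProbabilityMeasure (weighted h (N ω)) := by
  filter_upwards [hprob] with ω hω
  exact ⟨by rw [weighted, withDensity_apply _ MeasurableSet.univ, Measure.restrict_univ, hω]⟩

/-- The points of a Poisson random measure `N` can be read off from `h(w, N) N(dw)`, so that a
sample from this measure is also a conditional sample given `N`. -/
theorem IsPoissonRandomMeasure.lintegral_sample [MeasurableEq 𝓦] [MeasurableSingletonClass 𝓦]
    [SigmaFinite ν] [NullSingletonClass ν] [IsProbabilityMeasure Pr]
    (hN : IsPoissonRandomMeasure N ν Pr) (hmeas : Measurable h) (hpos : ∀ x, 0 < h x)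
    (hprob : ∀ᵐ ω ∂Pr, ∫⁻ w, (h (w, N ω) : ℝ≥0∞) ∂(N ω) = 1)
    (hW : IsConditionalLaw W (fun ω => weighted h (N ω))
      (fun P => Measure.pi (fun _ : Fin n => P)) Pr)
    {F : Measure 𝓦 → (Fin n → 𝓦) → ℝ≥0∞} (hF : Measurable (uncurry F)) :
    ∫⁻ ω, F (N ω) (W ω) ∂Pr =
      ∫⁻ ω, ∫⁻ w, F (N ω) w ∂(Measure.pi fun _ : Fin n => weighted h (N ω)) ∂Pr := by
  obtain ⟨κ, hκM, hκ, hcd⟩ := hW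
  have hrec : ∀ᵐ ω ∂Pr, recoverKernel ν (weighted h (N ω)) = N ω := by
    filter_upwards [ae_of_ae_map hN.measurable.aemeasurable hN.ae_ae_singleton_eq_one,
      ae_isProbabilityMeasure_weighted hprob] with ω h1 h2
    exact recoverKernel_weighted hmeas hpos h1
  have hG : Measurable fun x : Measure 𝓦 × (Fin n → 𝓦) => F (recoverKernel ν x.1) x.2 :=
    hF.comp (((recoverKernel ν).measurable.comp measurable_fst).prodMk measurable_snd)
  calc ∫⁻ ω, F (N ω) (W ω) ∂Pr
      = ∫⁻ ω, F (recoverKernel ν (weighted h (N ω))) (W ω) ∂Pr := by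
        refine lintegral_congr_ae ?_
        filter_upwards [hrec] with ω hω
        rw [hω]
    _ = ∫⁻ ω, ∫⁻ w, F (recoverKernel ν (weighted h (N ω))) w ∂(κ (weighted h (N ω))) ∂Pr := by
        have h1 := HasLaw.lintegral_comp hcd hG.aemeasurable
        have hP : AEMeasurable (fun ω => weighted h (N ω)) Pr := hcd.aemeasurable_fst
        rw [h1, Measure.lintegral_compProd hG,
          lintegral_map' (hG.lintegral_kernel_prod_right').aemeasurable hP]
    _ = _ := by
        refine lintegral_congr_ae ?_
        filter_upwards [hrec, hκ] with ω h1 h2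
        rw [h1, h2]

theorem IsPoissonRandomMeasure.lintegral_sample_eq_partitionMeasure [MeasurableEq 𝓦]
    [MeasurableSingletonClass 𝓦]
    [SigmaFinite ν] [NullSingletonClass ν] [IsProbabilityMeasure Pr]
    (hN : IsPoissonRandomMeasure N ν Pr) (hmeas : Measurable h) (hpos : ∀ x, 0 < h x)
    (hprob : ∀ᵐ ω ∂Pr, ∫⁻ w, (h (w, N ω) : ℝ≥0∞) ∂(N ω) = 1)
    (hW : IsConditionalLaw W (fun ω => weighted h (N ω))
      (fun P => Measure.pi (fun _ : Fin n => P)) Pr)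
    {F : Measure 𝓦 → (Fin n → 𝓦) → ℝ≥0∞} (hF : Measurable (uncurry F)) :
    ∫⁻ ω, F (N ω) (W ω) ∂Pr =
      ∫⁻ w, ∫⁻ M, likelihood h w M * F (starMeasure w M) w ∂(Pr.map N)
        ∂(partitionMeasure ν n) := by
  have hL : Measurable (uncurry fun (M : Measure 𝓦) (w : Fin n → 𝓦) =>
      (∏ i, (h (w i, M) : ℝ≥0∞)) * F M w) := by
    refine Measurable.mul (Finset.measurable_fun_prod _ fun i _ => ?_) hF
    exact (hmeas.comp (((measurable_pi_apply i).comp measurable_snd).prodMk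
      measurable_fst)).coe_nnreal_ennreal
  have hLM : Measurable fun M => ∫⁻ w, (∏ i, (h (w i, M) : ℝ≥0∞)) * F M w
      ∂(Measure.pi fun _ : Fin n => evalKernel ν M) :=
    measurable_lintegral_pi_kernel (evalKernel ν) hL
  rw [hN.lintegral_sample hmeas hpos hprob hW hF]
  calc ∫⁻ ω, ∫⁻ w, F (N ω) w ∂(Measure.pi fun _ : Fin n => weighted h (N ω)) ∂Pr
      = ∫⁻ ω, ∫⁻ w, (∏ i, (h (w i, N ω) : ℝ≥0∞)) * F (N ω) w
          ∂(Measure.pi fun _ : Fin n => evalKernel ν (N ω)) ∂Pr := by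
        refine lintegral_congr_ae ?_
        filter_upwards [ae_isProbabilityMeasure_weighted hprob, hN.ae_mem_locallyFinite]
          with ω h1 h2
        have := sigmaFinite_of_mem_locallyFinite h2
        have h3 : SigmaFinite ((N ω).withDensity fun w => (h (w, N ω) : ℝ≥0∞)) := by
          change SigmaFinite (weighted h (N ω)); infer_instance
        have hFm : Measurable fun w => F (N ω) w :=
          hF.comp (measurable_const.prodMk measurable_id)
        rw [evalKernel_apply_of_mem h2]
        exact lintegral_pi_withDensity (N ω) (measurable_weight hmeas (N ω)) hFm
    _ = ∫⁻ M, ∫⁻ w, (∏ i, (h (w i, M) : ℝ≥0∞)) * F M w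
          ∂(Measure.pi fun _ : Fin n => evalKernel ν M) ∂(Pr.map N) :=
        (lintegral_map hLM hN.measurable).symm
    _ = ∫⁻ M, ∫⁻ w, (∏ i, (h (w i, M) : ℝ≥0∞)) * F M w
          ∂(Measure.pi fun _ : Fin n => M) ∂(Pr.map N) := by
        refine lintegral_congr_ae ?_
        filter_upwards [hN.ae_map_mem_locallyFinite] with M hM
        rw [evalKernel_apply_of_mem hM]
    _ = _ := by
        rw [hN.mecke_pi hL]
        simp only [likelihood_eq_prod]

theorem map_map_starMeasure [MeasurableEq 𝓦] [SigmaFinite ν]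
    (hN : IsPoissonRandomMeasure N ν Pr) (hmeas : Measurable h) (w : Fin n → 𝓦) :
    ((piStar h (Pr.map N) w).map (starMeasure w)).map (weightedKernel ν h) =
      (piStar h (Pr.map N) w).map fun M => weighted h (starMeasure w M) := by
  rw [Measure.map_map (weightedKernel ν h).measurable (measurable_starMeasure_right w)]
  refine Measure.map_congr ?_
  refine (withDensity_absolutelyContinuous _ _).ae_le ?_
  filter_upwards [hN.ae_map_mem_locallyFinite] with M hM
  exact weightedKernel_apply hmeas (starMeasure_mem_locallyFinite w hM)

section Main

variable [MeasurableEq 𝓦] [MeasurableSingletonClass 𝓦] [SigmaFinite ν] [NullSingletonClass ν]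
  [IsProbabilityMeasure Pr]
  (hN : IsPoissonRandomMeasure N ν Pr) (hmeas : Measurable h) (hpos : ∀ x, 0 < h x)
  (hprob : ∀ᵐ ω ∂Pr, ∫⁻ w, (h (w, N ω) : ℝ≥0∞) ∂(N ω) = 1)
  (hW : IsConditionalLaw W (fun ω => weighted h (N ω))
    (fun P => Measure.pi (fun _ : Fin n => P)) Pr)

include hN hmeas hpos hprob hW

theorem map_sample_eq_withDensity :
    Pr.map W = (partitionMeasure ν n).withDensity (psi h (Pr.map N)) := by
  have hWm := hW.aemeasurable_left
  ext s hs
  have h1 := hN.lintegral_sample_eq_partitionMeasure hmeas hpos hprob hW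
    (F := fun _ w => s.indicator 1 w) ((measurable_one.indicator hs).comp measurable_snd)
  rw [← lintegral_map' (f := s.indicator 1) (measurable_one.indicator hs).aemeasurable hWm,
    lintegral_indicator_one hs] at h1
  rw [h1, withDensity_apply _ hs, ← lintegral_indicator hs]
  refine lintegral_congr fun w => ?_
  by_cases hw : w ∈ s <;> simp [hw, psi]

theorem ae_map_psi_ne_top : ∀ᵐ w ∂(Pr.map W), psi h (Pr.map N) w ≠ ∞ := by
  have : IsProbabilityMeasure (Pr.map N) :=
    Measure.isProbabilityMeasure_map hN.measurable.aemeasurable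
  have : IsProbabilityMeasure (Pr.map W) := Measure.isProbabilityMeasure_map hW.aemeasurable_left
  have hm := map_sample_eq_withDensity hN hmeas hpos hprob hW
  have hfin : ∫⁻ w, psi h (Pr.map N) w ∂(partitionMeasure ν n) ≠ ∞ := by
    rw [← setLIntegral_univ, ← withDensity_apply _ MeasurableSet.univ, ← hm]
    exact measure_ne_top _ _
  have hae := ae_lt_top (measurable_psi hmeas (Pr.map N)) hfin
  rw [hm]
  filter_upwards [(withDensity_absolutelyContinuous (partitionMeasure ν n) _).ae_le hae] with w hw
  exact hw.ne

theorem hasCondDistrib_of_kernel {κ : Kernel (Fin n → 𝓦) (Measure 𝓦)} [IsMarkovKernel κ]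
    (hκ : ∀ w, psi h (Pr.map N) w ≠ ∞ → κ w = (piStar h (Pr.map N) w).map (starMeasure w)) :
    HasCondDistrib N W κ Pr := by
  have : IsProbabilityMeasure (Pr.map N) :=
    Measure.isProbabilityMeasure_map hN.measurable.aemeasurable
  have hWm := hW.aemeasurable_left
  have : IsProbabilityMeasure (Pr.map W) := Measure.isProbabilityMeasure_map hWm
  have hpair : AEMeasurable (fun ω => (W ω, N ω)) Pr := hWm.prodMk hN.measurable.aemeasurable
  have hm := map_sample_eq_withDensity hN hmeas hpos hprob hW
  have htop : ∀ᵐ w ∂(partitionMeasure ν n), psi h (Pr.map N) w ≠ ∞ := by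
    have h1 := ae_map_psi_ne_top hN hmeas hpos hprob hW
    have hpsi := measurable_psi (n := n) hmeas (Pr.map N)
    rw [hm, ae_withDensity_iff hpsi] at h1
    filter_upwards [h1] with w hw
    exact hw (psi_pos hmeas hpos w).ne'
  refine ⟨hpair, Measure.ext_of_lintegral _ fun f hf => ?_⟩
  have hfs : Measurable (uncurry fun (M : Measure 𝓦) (w : Fin n → 𝓦) => f (w, M)) :=
    hf.comp measurable_swap
  rw [lintegral_map' hf.aemeasurable hpair,
    hN.lintegral_sample_eq_partitionMeasure hmeas hpos hprob hW hfs,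
    Measure.lintegral_compProd hf, hm,
    lintegral_withDensity_eq_lintegral_mul _ (measurable_psi hmeas _)
      hf.lintegral_kernel_prod_right']
  refine lintegral_congr_ae ?_
  filter_upwards [htop] with w hw
  have hfw : Measurable fun M => f (w, M) := hf.comp (measurable_const.prodMk measurable_id)
  rw [Pi.mul_apply, hκ w hw]
  exact (lintegral_map_piStar hmeas hpos hw hfw).symm

theorem isConditionalLaw_poisson :
    IsConditionalLaw N W (fun w => (piStar h (Pr.map N) w).map (starMeasure w)) Pr := by
  have : IsProbabilityMeasure (Pr.map N) :=
    Measure.isProbabilityMeasure_map hN.measurable.aemeasurable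
  obtain ⟨κ, hκM, hκ⟩ := exists_kernel_map_piStar (n := n) (Q := Pr.map N) hmeas hpos
  refine ⟨κ, hκM, ?_, hasCondDistrib_of_kernel hN hmeas hpos hprob hW hκ⟩
  filter_upwards [ae_of_ae_map hW.aemeasurable_left
    (ae_map_psi_ne_top hN hmeas hpos hprob hW)] with ω hω
  exact hκ _ hω

theorem isConditionalLaw_weighted :
    IsConditionalLaw (fun ω => weighted h (N ω)) W
      (fun w => (piStar h (Pr.map N) w).map fun M => weighted h (starMeasure w M)) Pr := by
  have : IsProbabilityMeasure (Pr.map N) :=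
    Measure.isProbabilityMeasure_map hN.measurable.aemeasurable
  obtain ⟨κ, hκM, hκ⟩ := exists_kernel_map_piStar (n := n) (Q := Pr.map N) hmeas hpos
  have hκN := hasCondDistrib_of_kernel hN hmeas hpos hprob hW hκ
  have hwm := (weightedKernel ν h).measurable
  refine ⟨κ.map (weightedKernel ν h), Kernel.IsMarkovKernel.map κ hwm, ?_, ?_⟩
  · filter_upwards [ae_of_ae_map hW.aemeasurable_left
      (ae_map_psi_ne_top hN hmeas hpos hprob hW)] with ω hω
    rw [Kernel.map_apply _ hwm, hκ _ hω, map_map_starMeasure hN hmeas]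
  · refine HasLaw.congr (hκN.comp_left hwm) ?_
    filter_upwards [hN.ae_mem_locallyFinite] with ω hω
    rw [comp_apply, weightedKernel_apply hmeas hω]

theorem ae_ae_isProbabilityMeasure_weighted_starMeasure :
    ∀ᵐ ω ∂Pr, ∀ᵐ M ∂(piStar h (Pr.map N) (W ω)),
      IsProbabilityMeasure (weighted h (starMeasure (W ω) M)) := by
  have : IsProbabilityMeasure (Pr.map N) :=
    Measure.isProbabilityMeasure_map hN.measurable.aemeasurable
  obtain ⟨κ, hκM, hκ⟩ := exists_kernel_map_piStar (n := n) (Q := Pr.map N) hmeas hpos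
  have hκN := hasCondDistrib_of_kernel hN hmeas hpos hprob hW hκ
  have hWm := hW.aemeasurable_left
  have hset : MeasurableSet {M : Measure 𝓦 | weightedKernel ν h M univ = 1} :=
    Kernel.measurable_coe _ MeasurableSet.univ (measurableSet_singleton 1)
  have hae : ∀ᵐ x ∂(Pr.map W ⊗ₘ κ), weightedKernel ν h x.2 univ = 1 := by
    rw [← hκN.map_eq, ae_map_iff hκN.aemeasurable (by exact measurable_snd hset)]
    filter_upwards [hN.ae_mem_locallyFinite, ae_isProbabilityMeasure_weighted hprob] with ω h1 h2
    rw [weightedKernel_apply hmeas h1, measure_univ]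
  filter_upwards [ae_of_ae_map hWm (Measure.ae_ae_of_ae_compProd hae),
    ae_of_ae_map hWm (ae_map_psi_ne_top hN hmeas hpos hprob hW)] with ω h1 h2
  rw [hκ _ h2] at h1
  have hLF : ∀ᵐ M ∂(piStar h (Pr.map N) (W ω)), M ∈ locallyFinite ν :=
    (withDensity_absolutelyContinuous _ _).ae_le hN.ae_map_mem_locallyFinite
  filter_upwards [ae_of_ae_map (measurable_starMeasure_right (W ω)).aemeasurable h1, hLF]
    with M h3 h4
  constructor
  rwa [weightedKernel_apply hmeas (starMeasure_mem_locallyFinite _ h4)] at h3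

theorem map_sample_perm (σ : Equiv.Perm (Fin n)) :
    Pr.map (fun ω i => W ω (σ i)) = Pr.map W := by
  have hWm := hW.aemeasurable_left
  have hσ : Measurable fun (w : Fin n → 𝓦) i => w (σ i) :=
    measurable_pi_lambda _ fun i => measurable_pi_apply _
  have hWσ : AEMeasurable (fun ω i => W ω (σ i)) Pr := hσ.comp_aemeasurable hWm
  refine Measure.ext_of_lintegral _ fun f hf => ?_
  have hfs : Measurable (uncurry fun (_ : Measure 𝓦) w => f w) := hf.comp measurable_snd
  have hfσ : Measurable (uncurry fun (_ : Measure 𝓦) (w : Fin n → 𝓦) => f fun i => w (σ i)) :=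
    (hf.comp hσ).comp measurable_snd
  rw [lintegral_map' hf.aemeasurable hWσ, lintegral_map' hf.aemeasurable hWm,
    hN.lintegral_sample hmeas hpos hprob hW hfs, hN.lintegral_sample hmeas hpos hprob hW hfσ]
  refine lintegral_congr_ae ?_
  filter_upwards [ae_isProbabilityMeasure_weighted hprob] with ω hω
  exact (lintegral_pi_reindex _ σ f).symm

theorem measure_tiePartition_eq (p : Finpartition (Finset.univ : Finset (Fin n))) :
    Pr {ω | tiePartition (W ω) = p} =
      ∫⁻ v, psi h (Pr.map N) (assemble p v) ∂(Measure.pi fun _ : p.parts => ν) := by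
  have : IsProbabilityMeasure (Pr.map N) :=
    Measure.isProbabilityMeasure_map hN.measurable.aemeasurable
  have hset := measurableSet_tiePartition_eq (𝓦 := 𝓦) p
  have hpsi := measurable_psi (n := n) hmeas (Pr.map N)
  have h1 : Pr {ω | tiePartition (W ω) = p} = Pr.map W {w | tiePartition w = p} :=
    (Measure.map_apply_of_aemeasurable hW.aemeasurable_left hset).symm
  rw [h1, map_sample_eq_withDensity hN hmeas hpos hprob hW, withDensity_apply _ hset,
    ← lintegral_indicator hset, partitionMeasure, lintegral_finsetSum_measure,
    Finset.sum_eq_single p]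
  · rw [lintegral_map (hpsi.indicator hset) (measurable_assemble p)]
    refine lintegral_congr_ae ?_
    filter_upwards [ae_injective_pi ν p.parts] with v hv
    exact indicator_of_mem (show assemble p v ∈ {w | tiePartition w = p} from
      (tiePartition_assemble_eq_iff p).2 hv) _
  · intro q _ hq
    rw [lintegral_map (hpsi.indicator hset) (measurable_assemble q),
      lintegral_congr_ae (g := fun _ => 0), lintegral_zero]
    filter_upwards [ae_injective_pi ν q.parts] with v hv
    refine indicator_of_notMem (fun hmem => hq ?_) _
    rw [← (tiePartition_assemble_eq_iff q).2 hv]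
    exact hmem
  · simp

theorem measure_tiePartition_eq_of_cellSizes_eq
    {p q : Finpartition (Finset.univ : Finset (Fin n))} (hpq : cellSizes p = cellSizes q) :
    Pr {ω | tiePartition (W ω) = p} = Pr {ω | tiePartition (W ω) = q} := by
  obtain ⟨σ, hσ⟩ := exists_perm_of_cellSizes_eq hpq
  have hWm := hW.aemeasurable_left
  have hσm : Measurable fun (w : Fin n → 𝓦) i => w (σ i) :=
    measurable_pi_lambda _ fun i => measurable_pi_apply _
  have hWσ : AEMeasurable (fun ω i => W ω (σ i)) Pr := hσm.comp_aemeasurable hWm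
  have hset := measurableSet_tiePartition_eq (𝓦 := 𝓦) p
  calc Pr {ω | tiePartition (W ω) = p} = Pr.map W {w | tiePartition w = p} :=
        (Measure.map_apply_of_aemeasurable hWm hset).symm
    _ = Pr {ω | tiePartition (fun i => W ω (σ i)) = p} := by
        rw [← map_sample_perm hN hmeas hpos hprob hW σ,
          Measure.map_apply_of_aemeasurable hWσ hset]
        rfl
    _ = _ := by
        congr 1
        ext ω
        simp only [mem_ofPred_eq, tiePartition_eq_iff, hσ]
        exact ⟨fun H i j => by simpa using H (σ.symm i) (σ.symm j), fun H i j => H _ _⟩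

end Main

end Sampling

end PoissonPartition

theorem theorem3p1 {Ω 𝓦 : Type*} [MeasurableSpace Ω] (Pr : Measure Ω) [IsProbabilityMeasure Pr]
    [TopologicalSpace 𝓦] [PolishSpace 𝓦] [MeasurableSpace 𝓦] [BorelSpace 𝓦]
    (ν : Measure 𝓦) [SigmaFinite ν] [NullSingletonClass ν]
    (N : Ω → Measure 𝓦) (hN : PoissonPartition.IsPoissonRandomMeasure N ν Pr)
    (h : 𝓦 × Measure 𝓦 → ℝ≥0) (hmeas : Measurable h) (hpos : ∀ x, 0 < h x)
    -- `P(dw) = h(w, N) N(dw)` is almost surely a probability measure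
    (hprob : ∀ᵐ ω ∂Pr, ∫⁻ w, (h (w, N ω) : ℝ≥0∞) ∂(N ω) = 1)
    (n : ℕ) (W : Ω → Fin n → 𝓦)
    -- given `P`, the variables `W₁, …, W_n` are i.i.d. with distribution `P`
    (hW : PoissonPartition.IsConditionalLaw W (fun ω => PoissonPartition.weighted h (N ω))
      (fun P => Measure.pi (fun _ : Fin n => P)) Pr) :
    -- `ψ_n(W)` is positive and finite
    (∀ᵐ ω ∂Pr, 0 < PoissonPartition.psi h (Pr.map N) (W ω) ∧
      PoissonPartition.psi h (Pr.map N) (W ω) < ∞) ∧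
    -- (i) the posterior distribution of `N`
    PoissonPartition.IsConditionalLaw N W
      (fun w => (PoissonPartition.piStar h (Pr.map N) w).map (PoissonPartition.starMeasure w)) Pr ∧
    -- (ii) the posterior distribution of `P`
    PoissonPartition.IsConditionalLaw (fun ω => PoissonPartition.weighted h (N ω)) W
      (fun w => (PoissonPartition.piStar h (Pr.map N) w).map
        (fun N' => PoissonPartition.weighted h (PoissonPartition.starMeasure w N'))) Pr ∧
    (∀ᵐ ω ∂Pr, ∀ᵐ N' ∂(PoissonPartition.piStar h (Pr.map N) (W ω)),
      IsProbabilityMeasure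
        (PoissonPartition.weighted h (PoissonPartition.starMeasure (W ω) N'))) ∧
    (∀ (w : Fin n → 𝓦) (N' : Measure 𝓦),
      PoissonPartition.weighted h (PoissonPartition.starMeasure w N') =
        N'.withDensity (fun v => (h (v, PoissonPartition.starMeasure w N') : ℝ≥0∞)) +
          ∑ v ∈ PoissonPartition.distinctValues w,
            (h (v, PoissonPartition.starMeasure w N') : ℝ≥0∞) • Measure.dirac v) ∧
    -- (iii) the marginal distribution of `W`, its exchangeability, and the EPPF
    Pr.map W = (PoissonPartition.partitionMeasure ν n).withDensity
      (PoissonPartition.psi h (Pr.map N)) ∧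
    (∀ σ : Equiv.Perm (Fin n), Pr.map (fun ω i => W ω (σ i)) = Pr.map W) ∧
    ∃ eppf : Multiset ℕ → ℝ≥0∞, ∀ p : Finpartition (Finset.univ : Finset (Fin n)),
      Pr {ω | PoissonPartition.tiePartition (W ω) = p} = eppf (PoissonPartition.cellSizes p) ∧
      eppf (PoissonPartition.cellSizes p) =
        ∫⁻ v, PoissonPartition.psi h (Pr.map N) (PoissonPartition.assemble p v)
          ∂(Measure.pi (fun _ : p.parts => ν)) := by
  classical
  have hpsi := PoissonPartition.ae_map_psi_ne_top hN hmeas hpos hprob hW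
  have : IsProbabilityMeasure (Pr.map N) :=
    Measure.isProbabilityMeasure_map hN.measurable.aemeasurable
  refine ⟨?_, PoissonPartition.isConditionalLaw_poisson hN hmeas hpos hprob hW,
    PoissonPartition.isConditionalLaw_weighted hN hmeas hpos hprob hW,
    PoissonPartition.ae_ae_isProbabilityMeasure_weighted_starMeasure hN hmeas hpos hprob hW,
    PoissonPartition.weighted_starMeasure hmeas,
    PoissonPartition.map_sample_eq_withDensity hN hmeas hpos hprob hW,
    PoissonPartition.map_sample_perm hN hmeas hpos hprob hW,
    fun m => if hm : ∃ p, PoissonPartition.cellSizes (n := n) p = m then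
      Pr {ω | PoissonPartition.tiePartition (W ω) = hm.choose} else 0, fun p => ?_⟩
  · filter_upwards [ae_of_ae_map hW.aemeasurable_left hpsi] with ω hω
    exact ⟨PoissonPartition.psi_pos hmeas hpos _, hω.lt_top⟩
  · have hp : ∃ q, PoissonPartition.cellSizes (n := n) q = PoissonPartition.cellSizes p := ⟨p, rfl⟩
    have heq : Pr {ω | PoissonPartition.tiePartition (W ω) = hp.choose} =
        Pr {ω | PoissonPartition.tiePartition (W ω) = p} :=
      PoissonPartition.measure_tiePartition_eq_of_cellSizes_eq hN hmeas hpos hprob hW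
        hp.choose_spec
    beta_reduce
    rw [dif_pos hp, heq]
    exact ⟨rfl, PoissonPartition.measure_tiePartition_eq hN hmeas hpos hprob hW p⟩
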